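/- Let $\mathbb{K}$ be a field of characteristic zero and $n\ge 0$. Let $\operatorname{U}(n)=\mathbb{K}[\tilde h_1,\dots,\tilde h_n]$, put $\tilde h_{ij}=\tilde h_i-\tilde h_j$, and let $\bar{\operatorname{U}}(n)$ be the localization of $\operatorname{U}(n)$ at the multiplicative set generated by the elements $\tilde h_{ij}+k$ with $k\in\mathbb{Z}$ and $i\ne j$. For $f\in\bar{\operatorname{U}}(n)$ let $f[-\varepsilon_j]$ be the image of $f$ under the $\mathbb{K}$-algebra automorphism $\tilde h_i\mapsto \tilde h_i-\delta_{ij}$, and let $\Delta_jf=f-f[-\varepsilon_j]$. Let $\hat{\mathrm R}^{ij}_{kl}\in\bar{\operatorname{U}}(n)$, $1\le i,j,k,l\le n$, be the array whose only non-zero entries are $$\hat{\mathrm R}^{ij}_{ij}=\frac1{\tilde h_{ij}}\ (i\ne j),\qquad \hat{\mathrm R}^{ij}_{ji}=\frac{\tilde h_{ij}^2-1}{\tilde h_{ij}^2}\ (i<j),\qquad \hat{\mathrm R}^{ij}_{ji}=1\ (i\ge j).$$ Given $\sigma_1,\dots,\sigma_n\in\bar{\operatorname{U}}(n)$, let $\mathrm{Diff}_{\mathbf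 h}(\sigma_1,\dots,\sigma_n)$ be the $\mathbb{K}$-algebra generated by (the image of) $\bar{\operatorname{U}}(n)$ and elements $x^i,\bar\partial_i$, $i=1,\dots,n$, with the defining relations, in addition to those of $\bar{\operatorname{U}}(n)$, $$\tilde h_ix^j=x^j(\tilde h_i+\delta_{ij}),\qquad \tilde h_i\bar\partial_j=\bar\partial_j(\tilde h_i-\delta_{ij}),$$ $$x^ix^j=\sum_{k,l}\hat{\mathrm R}^{ij}_{kl}\,x^kx^l,\qquad \bar\partial_l\bar\partial_k=\sum_{i,j}\bar\partial_j\bar\partial_i\,\hat{\mathrm R}^{ij}_{kl},\qquad x^i\bar\partial_j=\sum_{k,l}\bar\partial_k\,\hat{\mathrm R}^{ki}_{lj}\,x^l-\delta_{ij}\,\sigma_i .$$ Then $\mathrm{Diff}_{\mathbf h}(\sigma_1,\dots,\sigma_n)$ has the Poincaré–Birkhoff–Witt property, that is, the monomials $$\bar\partial_n^{\,l_n}\cdots\bar\partial_1^{\,l_1}\,(x^1)^{k_1}\cdots(x^n)^{k_n},\qquad k_1,\dots,k_n,l_1,\dots,l_n\in\mathbb{Z}_{\ge0},$$ form a basis of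 it as a left $\bar{\operatorname{U}}(n)$-module, if and only if $$\tilde h_{ij}\,\Delta_j\sigma_i=\sigma_i-\sigma_j\qquad\text{for all } i,j=1,\dots,n.$$ -/

import Mathlib

noncomputable section

namespace HDeformed

variable (K : Type*) [Field K] (n : ℕ)

/-- The multiplicative set of denominators in `U(n) = K[h̃₁, …, h̃ₙ]`, generated by the elements
`h̃ᵢ - h̃ⱼ + k` with `i ≠ j` and `k ∈ ℤ`. The enveloping algebra of the abelian Lie algebra with
basis `h̃₁, …, h̃ₙ` is the polynomial ring in these elements. -/
def denominators : Submonoid (MvPolynomial (Fin n) K) :=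
  Submonoid.closure {p | ∃ (i j : Fin n) (k : ℤ), i ≠ j ∧
    p = MvPolynomial.X i - MvPolynomial.X j + MvPolynomial.C (k : K)}

/-- The ring of fractions `Ū(n)`. -/
abbrev UBar : Type _ := Localization (denominators K n)

variable {K n}

/-- The element `h̃ᵢ` of `Ū(n)`. -/
def hTilde (i : Fin n) : UBar K n :=
  algebraMap (MvPolynomial (Fin n) K) (UBar K n) (MvPolynomial.X i)

variable (K) in
theorem sub_mem_denominators {i j : Fin n} (hij : i ≠ j) :
    (MvPolynomial.X i - MvPolynomial.X j : MvPolynomial (Fin n) K) ∈ denominators K n :=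
  Submonoid.subset_closure ⟨i, j, 0, hij, by simp⟩

variable (K) in
/-- The element `1 / h̃ᵢⱼ = 1 / (h̃ᵢ - h̃ⱼ)` of `Ū(n)`, for `i ≠ j`. -/
def invH (i j : Fin n) (hij : i ≠ j) : UBar K n :=
  Localization.mk 1 ⟨MvPolynomial.X i - MvPolynomial.X j, sub_mem_denominators K hij⟩

theorem sub_mul_invH {i j : Fin n} (hij : i ≠ j) :
    (hTilde i - hTilde j : UBar K n) * invH K i j hij = 1 := by
  unfold hTilde invH
  rw [← map_sub, ← Localization.mk_one_eq_algebraMap, Localization.mk_mul, mul_one, one_mul]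
  exact Localization.mk_self ⟨_, sub_mem_denominators K hij⟩

/-- The translation `h̃ᵢ ↦ h̃ᵢ + c δᵢⱼ` of `U(n)`. -/
def polyTranslate (j : Fin n) (c : ℤ) : MvPolynomial (Fin n) K →ₐ[K] MvPolynomial (Fin n) K :=
  MvPolynomial.aeval fun i =>
    MvPolynomial.X i + MvPolynomial.C (((if i = j then c else 0 : ℤ)) : K)

theorem denominators_le_comap (j : Fin n) (c : ℤ) :
    denominators K n ≤ (denominators K n).comap (polyTranslate (K := K) j c).toRingHom := by
  rw [denominators, Submonoid.closure_le]
  rintro p ⟨a, b, k, hab, rfl⟩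
  refine Submonoid.subset_closure
    ⟨a, b, k + (if a = j then c else 0) - (if b = j then c else 0), hab, ?_⟩
  simp only [polyTranslate, AlgHom.toRingHom_eq_coe, RingHom.coe_coe, map_add, map_sub,
    MvPolynomial.aeval_X, MvPolynomial.algHom_C, MvPolynomial.algebraMap_eq, Int.cast_add,
    Int.cast_sub]
  ring

/-- The translation `f ↦ f[c εⱼ]` of `Ū(n)`, the ring map with `h̃ᵢ ↦ h̃ᵢ + c δᵢⱼ`. -/
def translate (j : Fin n) (c : ℤ) : UBar K n →+* UBar K n :=
  IsLocalization.map (UBar K n) (polyTranslate (K := K) j c).toRingHom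
    (denominators_le_comap (K := K) j c)

theorem translate_hTilde (i j : Fin n) (c : ℤ) :
    translate j c (hTilde i : UBar K n) = hTilde i + ((if i = j then c else 0 : ℤ) : UBar K n) := by
  simp only [translate, hTilde, IsLocalization.map_eq, polyTranslate, AlgHom.toRingHom_eq_coe,
    RingHom.coe_coe, MvPolynomial.aeval_X, map_add]
  split_ifs <;> simp

/-- The finite difference operator `Δⱼ f = f - f[-εⱼ]`. -/
def delta (j : Fin n) (f : UBar K n) : UBar K n := f - translate j (-1) f

variable (K) in
/-- The entry `R̂^{ij}_{kl}` (upper indices `i j`, lower indices `k l`) of the dynamical R-matrix: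
`R̂^{ij}_{ij} = 1 / h̃ᵢⱼ` for `i ≠ j`; `R̂^{ij}_{ji} = (h̃ᵢⱼ² - 1) / h̃ᵢⱼ²` for `i < j` and
`R̂^{ij}_{ji} = 1` for `i ≥ j`; the other entries are zero. -/
def rHat (i j k l : Fin n) : UBar K n :=
  if hd : i ≠ j ∧ k = i ∧ l = j then invH K i j hd.1
  else if k = j ∧ l = i then
    if hlt : i < j then ((hTilde i - hTilde j) ^ 2 - 1) * invH K i j hlt.ne ^ 2 else 1
  else 0

variable (K n) in
/-- Letters of the free algebra: elements of `Ū(n)`, the `xⁱ`, and the `∂̄ᵢ`. -/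
inductive Letter : Type _
  | scalar (f : UBar K n)
  | x (i : Fin n)
  | d (i : Fin n)

variable (K n) in
/-- The free `K`-algebra on these letters. -/
abbrev Words : Type _ := FreeAlgebra K (Letter K n)

/-- The word consisting of the letter `f ∈ Ū(n)`. -/
def wS (f : UBar K n) : Words K n := FreeAlgebra.ι K (Letter.scalar f)

variable (K) in
/-- The word `xⁱ`. -/
def wX (i : Fin n) : Words K n := FreeAlgebra.ι K (Letter.x i)

variable (K) in
/-- The word `∂̄ᵢ`. -/
def wD (i : Fin n) : Words K n := FreeAlgebra.ι K (Letter.d i)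

/-- The defining relations of `Diff_h(σ₁, …, σₙ)`. The first three say that `Ū(n)` maps to the
quotient by a homomorphism of `K`-algebras. -/
inductive Rel (σ : Fin n → UBar K n) : Words K n → Words K n → Prop
  | scalar_algebraMap (c : K) :
      Rel σ (wS (algebraMap K (UBar K n) c)) (algebraMap K (Words K n) c)
  | scalar_add (f g : UBar K n) : Rel σ (wS (f + g)) (wS f + wS g)
  | scalar_mul (f g : UBar K n) : Rel σ (wS (f * g)) (wS f * wS g)
  | weight_x (i j : Fin n) :
      Rel σ (wS (hTilde i) * wX K j)
        (wX K j * (wS (hTilde i) + if i = j then 1 else 0))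
  | weight_d (i j : Fin n) :
      Rel σ (wS (hTilde i) * wD K j)
        (wD K j * (wS (hTilde i) - if i = j then 1 else 0))
  | x_x (i j : Fin n) :
      Rel σ (wX K i * wX K j)
        (∑ k, ∑ l, wS (rHat K i j k l) * wX K k * wX K l)
  | d_d (k l : Fin n) :
      Rel σ (wD K l * wD K k)
        (∑ i, ∑ j, wD K j * wD K i * wS (rHat K i j k l))
  | x_d (i j : Fin n) :
      Rel σ (wX K i * wD K j)
        ((∑ k, ∑ l, wD K k * wS (rHat K k i l j) * wX K l) - if i = j then wS (σ i) else 0)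

/-- The ring `Diff_h(σ₁, …, σₙ)`. -/
def Diff (σ : Fin n → UBar K n) : Type _ := RingQuot (Rel σ)

instance (σ : Fin n → UBar K n) : Ring (Diff σ) := inferInstanceAs (Ring (RingQuot (Rel σ)))

instance (σ : Fin n → UBar K n) : Algebra K (Diff σ) :=
  inferInstanceAs (Algebra K (RingQuot (Rel σ)))

/-- The quotient map from the free algebra. -/
def quot (σ : Fin n → UBar K n) : Words K n →ₐ[K] Diff σ := RingQuot.mkAlgHom K (Rel σ)

theorem quot_rel (σ : Fin n → UBar K n) {a b : Words K n} (h : Rel σ a b) :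
    quot σ a = quot σ b := RingQuot.mkAlgHom_rel K h

/-- The structure homomorphism `Ū(n) → Diff_h(σ₁, …, σₙ)`. -/
def scalarHom (σ : Fin n → UBar K n) : UBar K n →+* Diff σ where
  toFun f := quot σ (wS f)
  map_one' := by
    have h := quot_rel σ (Rel.scalar_algebraMap (σ := σ) 1)
    rwa [map_one, map_one, map_one] at h
  map_zero' := by
    have h := quot_rel σ (Rel.scalar_algebraMap (σ := σ) 0)
    rwa [map_zero, map_zero, map_zero] at h
  map_mul' f g := by
    rw [quot_rel σ (Rel.scalar_mul f g), map_mul]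
  map_add' f g := by
    rw [quot_rel σ (Rel.scalar_add f g), map_add]

/-- `Diff_h(σ₁, …, σₙ)` as a left `Ū(n)`-module: `f • r` is the product of the image of `f`
with `r`. -/
instance (σ : Fin n → UBar K n) : Module (UBar K n) (Diff σ) :=
  Module.compHom (Diff σ) (scalarHom σ)

/-- The generator `xⁱ` of `Diff_h(σ₁, …, σₙ)`. -/
def x (σ : Fin n → UBar K n) (i : Fin n) : Diff σ := quot σ (wX K i)

/-- The generator `∂̄ᵢ` of `Diff_h(σ₁, …, σₙ)`. -/
def dBar (σ : Fin n → UBar K n) (i : Fin n) : Diff σ := quot σ (wD K i)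

/-- The PBW property with respect to `r₁, …, rₘ`: the monomials `r₁^k₁ ⋯ rₘ^kₘ`, indexed by
`(k₁, …, kₘ)`, form a basis over the commutative ring `U`. -/
def HasPBW (U : Type*) {R : Type*} [CommRing U] [Ring R] [Module U R] {m : ℕ}
    (r : Fin m → R) : Prop :=
  ∃ b : Module.Basis (Fin m → ℕ) U R, ∀ k, b k = (List.ofFn fun a => r a ^ k a).prod

/-- The ordered family `∂̄ₙ, …, ∂̄₁, x¹, …, xⁿ`. -/
def generators (σ : Fin n → UBar K n) : Fin (n + n) → Diff σ :=
  Fin.append (fun a => dBar σ a.rev) (x σ)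

end HDeformed

end

/-! The ordered monomials always span: the xⁱ commute with each other up to scalars, so do the ∂̄ᵢ,
and xⁱ∂̄ⱼ rewrites into terms ∂̄ f x and a scalar (`span_orderedMonomial_generators`). Only linear
independence depends on σ.

Necessity is an overlap computation. If the monomials form a basis, the coefficient of xʲ vanishes
on every product ∂̄ₖv. Reading it off xⁱxʲ∂̄ᵢ before and after exchanging xⁱ and xʲ gives the
difference equation (`delta_eq_of_hasPBW`).

For sufficiency, a representation is built in which the monomials are visibly independent. Let F be
the fraction field of Ū(n). The elements Γᵢ = ∂̄ᵢxⁱ are to act by multiplication on F[Γ₁, …, Γₙ],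
with xⁱ acting as a scalar times a ring automorphism `tau i` and ∂̄ᵢ as Γᵢ(xⁱ)⁻¹. Multiplying the
relation for xⁱ∂̄ᵢ by xⁱ on the right forces `tau i` to send Γᵢ to ∑ₖ Γₖ/(hₖ-hᵢ+1) - σᵢ; the other
Γₖ are only rescaled. The difference equations make the constant terms match, so that the `tau i`
commute (`tau_tau_X_self`, `tau_comm`); the scalars `scale i` turn this into the R-matrix exchange
relations.

Independence of the operators: a monomial shifts the hᵢ by its weight, so Dedekind's independence of
characters separates different weights. Within one weight a monomial is determined by its
∂̄-exponents, and its value at 1 is a nonzero scalar times a vector `lowering l`. These vectors are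
independent by a dimension count in bounded degree (`linearIndependent_lowering`). -/

noncomputable section
namespace HDeformed

/-! ### Ordered monomials -/

/-- The ordered monomial `r₁^k₁ ⋯ rₘ^kₘ`. -/
def orderedMonomial {R : Type*} [Monoid R] {m : ℕ} (r : Fin m → R) (k : Fin m → ℕ) : R :=
  (List.ofFn fun a => r a ^ k a).prod

section OrderedMonomial

variable {R : Type*} [Monoid R]

theorem orderedMonomial_succ {m : ℕ} (r : Fin (m + 1) → R) (k : Fin (m + 1) → ℕ) :
    orderedMonomial r k =
      r 0 ^ k 0 * orderedMonomial (fun a => r a.succ) (fun a => k a.succ) := by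
  simp [orderedMonomial, List.ofFn_succ]

theorem orderedMonomial_append {p q : ℕ} (r : Fin p → R) (r' : Fin q → R)
    (k : Fin (p + q) → ℕ) :
    orderedMonomial (Fin.append r r') k =
      orderedMonomial r (fun a => k (Fin.castAdd q a)) *
        orderedMonomial r' (fun a => k (Fin.natAdd p a)) := by
  rw [orderedMonomial, List.ofFn_add, List.prod_append]
  simp only [orderedMonomial, Fin.append_right]
  congr 4
  ext a
  exact congrArg₂ (fun x e => x ^ k e) (Fin.append_left r r' a) rfl

theorem orderedMonomial_zero {m : ℕ} (r : Fin m → R) : orderedMonomial r 0 = 1 := by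
  induction m with
  | zero => simp [orderedMonomial]
  | succ m ih =>
    rw [orderedMonomial_succ]
    have : (fun c : Fin m => (0 : Fin (m + 1) → ℕ) c.succ) = 0 := rfl
    rw [this, ih]; simp

theorem orderedMonomial_single {m : ℕ} (r : Fin m → R) (a : Fin m) :
    orderedMonomial r (Pi.single a 1) = r a := by
  induction m with
  | zero => exact a.elim0
  | succ m ih =>
    rw [orderedMonomial_succ]
    refine Fin.cases ?_ (fun b => ?_) a
    · have : (fun c : Fin m => (Pi.single (0 : Fin (m + 1)) 1 : Fin (m + 1) → ℕ) c.succ) = 0 := by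
        ext c; simp [Fin.succ_ne_zero]
      rw [this, orderedMonomial_zero]; simp
    · have : (fun c : Fin m => (Pi.single b.succ 1 : Fin (m + 1) → ℕ) c.succ) =
          Pi.single b 1 := by
        ext c; simp [Pi.single_apply]
      rw [this, ih]; simp [(Fin.succ_ne_zero b).symm]

theorem map_orderedMonomial {S G : Type*} [Monoid S] [FunLike G R S] [MonoidHomClass G R S]
    (φ : G) {m : ℕ} (r : Fin m → R) (k : Fin m → ℕ) :
    φ (orderedMonomial r k) = orderedMonomial (fun a => φ (r a)) k := by
  simp [orderedMonomial, map_list_prod, List.map_ofFn, Function.comp_def]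

/-- Induction along the factors of an ordered monomial. -/
theorem orderedMonomial_mul_induction {m : ℕ} (r : Fin m → R) (P : R → Prop)
    (h : ∀ a y, P y → P (r a * y)) (k : Fin m → ℕ) (y : R) (hy : P y) :
    P (orderedMonomial r k * y) := by
  have hpow : ∀ a (e : ℕ) y, P y → P (r a ^ e * y) := by
    intro a e
    induction e with
    | zero => intro y hy; simpa using hy
    | succ e ih => intro y hy; rw [pow_succ, mul_assoc]; exact ih _ (h _ _ hy)
  induction m with
  | zero => simpa [orderedMonomial] using hy
  | succ m ih =>
    rw [orderedMonomial_succ, mul_assoc]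
    exact hpow _ _ _ (ih _ (fun a => h _) _ (fun a => hpow _))

end OrderedMonomial

/-! ### Sorting factors that commute up to scalars -/

section Sorting

variable {U R : Type*} [CommRing U] [Ring R] (s : U →+* R)

/-- In a family of normal elements that commute up to scalars, a factor can be moved to its place
in an ordered monomial. -/
theorem exists_mul_orderedMonomial {m : ℕ} (r : Fin m → R)
    (hn : ∀ a f, ∃ g, r a * s f = s g * r a)
    (hc : ∀ a b, ∃ c, r a * r b = s c * (r b * r a)) (a : Fin m) (k : Fin m → ℕ) :
    ∃ c, r a * orderedMonomial r k = s c * orderedMonomial r (k + Pi.single a 1) := by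
  have hnp : ∀ a (e : ℕ) f, ∃ g, r a ^ e * s f = s g * r a ^ e := by
    intro a e
    induction e with
    | zero => intro f; exact ⟨f, by simp⟩
    | succ e ih =>
      intro f
      obtain ⟨g, hg⟩ := hn a f
      obtain ⟨g', hg'⟩ := ih g
      exact ⟨g', by rw [pow_succ, mul_assoc, hg, ← mul_assoc, hg', mul_assoc]⟩
  have hcp : ∀ a b (e : ℕ), ∃ c, r a * r b ^ e = s c * (r b ^ e * r a) := by
    intro a b e
    induction e with
    | zero => exact ⟨1, by simp⟩
    | succ e ih =>
      obtain ⟨c, hc'⟩ := ih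
      obtain ⟨c₁, h₁⟩ := hc a b
      obtain ⟨c₂, h₂⟩ := hnp b e c₁
      refine ⟨c * c₂, ?_⟩
      calc r a * r b ^ (e + 1) = (r a * r b ^ e) * r b := by rw [pow_succ, mul_assoc]
        _ = s c * (r b ^ e * (r a * r b)) := by rw [hc']; simp only [mul_assoc]
        _ = s c * ((r b ^ e * s c₁) * (r b * r a)) := by rw [h₁]; simp only [mul_assoc]
        _ = _ := by rw [h₂, map_mul, pow_succ]; simp only [mul_assoc]
  induction m with
  | zero => exact a.elim0
  | succ m ih =>
    refine Fin.cases ?_ (fun b => ?_) a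
    · refine ⟨1, ?_⟩
      have : (fun c : Fin m => (k + Pi.single 0 1 : Fin (m + 1) → ℕ) c.succ) = fun c => k c.succ := by
        ext c; simp [Fin.succ_ne_zero]
      rw [orderedMonomial_succ, orderedMonomial_succ, this]
      simp [pow_succ', mul_assoc]
    · obtain ⟨c, h⟩ := ih (fun a => r a.succ) (fun a => hn _) (fun a b => hc _ _) b
        (fun a => k a.succ) (fun a => hnp _) (fun a b => hcp _ _)
      have : (fun c : Fin m => (k + Pi.single b.succ 1 : Fin (m + 1) → ℕ) c.succ) =
          (fun c => k c.succ) + Pi.single b 1 := by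
        ext c; simp [Pi.single_apply]
      have h0 : (k + Pi.single b.succ 1 : Fin (m + 1) → ℕ) 0 = k 0 := by
        simp [(Fin.succ_ne_zero b).symm]
      obtain ⟨c₁, h₁⟩ := hcp b.succ 0 (k 0)
      obtain ⟨c₂, h₂⟩ := hnp 0 (k 0) c
      refine ⟨c₁ * c₂, ?_⟩
      rw [orderedMonomial_succ, orderedMonomial_succ, this, h0, ← mul_assoc, h₁, mul_assoc,
        mul_assoc, h, ← mul_assoc (r 0 ^ k 0), h₂, map_mul]
      simp only [mul_assoc]

end Sorting

end HDeformed
end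

noncomputable section
namespace HDeformed

variable {K : Type*} [Field K] {n : ℕ}

/-! ### Sums over the R-matrix -/

section RMatrix

theorem isUnit_hTilde_sub_add {i j : Fin n} (hij : i ≠ j) (k : ℤ) :
    IsUnit (hTilde i - hTilde j + (k : UBar K n)) := by
  have h := IsLocalization.map_units (UBar K n)
    (⟨MvPolynomial.X i - MvPolynomial.X j + MvPolynomial.C (k : K),
      Submonoid.subset_closure ⟨i, j, k, hij, rfl⟩⟩ : denominators K n)
  simpa [hTilde] using h

theorem isUnit_hTilde_sub {i j : Fin n} (hij : i ≠ j) :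
    IsUnit (hTilde i - hTilde j : UBar K n) := by
  simpa using isUnit_hTilde_sub_add (K := K) hij 0

theorem rHat_diag {i j : Fin n} (hij : i ≠ j) : (rHat K i j i j : UBar K n) = invH K i j hij := by
  simp [rHat, hij]

theorem rHat_anti_of_lt {i j : Fin n} (hij : i < j) :
    (rHat K i j j i : UBar K n) =
      ((hTilde i - hTilde j) ^ 2 - 1) * invH K i j hij.ne ^ 2 := by
  simp [rHat, hij, hij.ne, hij.ne']

theorem rHat_anti_of_le {i j : Fin n} (hij : j ≤ i) : (rHat K i j j i : UBar K n) = 1 := by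
  have : ¬ (i ≠ j ∧ j = i ∧ i = j) := fun h => h.1 h.2.2
  simp [rHat, this, hij.not_gt]

theorem rHat_eq_zero {i j k l : Fin n} (h₁ : ¬ (k = i ∧ l = j)) (h₂ : ¬ (k = j ∧ l = i)) :
    (rHat K i j k l : UBar K n) = 0 := by
  have : ¬ (i ≠ j ∧ k = i ∧ l = j) := fun h => h₁ h.2
  simp [rHat, this, h₂]

variable {M : Type*} [AddCommMonoid M] (F : UBar K n → Fin n → Fin n → M)
  (h0 : ∀ k l, F 0 k l = 0)

include h0

/-- At most two entries of the array survive. Keeping `F` abstract lets one collapse serve scalars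
in any position, in the algebra and in its representation. -/
theorem sum_rHat_lower {i j : Fin n} (hij : i ≠ j) :
    ∑ k, ∑ l, F (rHat K i j k l) k l = F (invH K i j hij) i j + F (rHat K i j j i) j i := by
  rw [← Fintype.sum_prod_type' (f := fun k l => F (rHat K i j k l) k l),
    Finset.sum_eq_add (i, j) (j, i) (by simp [hij]) _ (by simp) (by simp), rHat_diag hij]
  rintro ⟨k, l⟩ - ⟨h₁, h₂⟩
  rw [rHat_eq_zero (by simpa using h₁) (by simpa using h₂), h0]

theorem sum_rHat_lower_self (i : Fin n) :
    ∑ k, ∑ l, F (rHat K i i k l) k l = F 1 i i := by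
  rw [← Fintype.sum_prod_type' (f := fun k l => F (rHat K i i k l) k l),
    Finset.sum_eq_single (i, i) _ (by simp), rHat_anti_of_le le_rfl]
  rintro ⟨k, l⟩ - h
  rw [rHat_eq_zero (by simpa using h) (by simpa using h), h0]

theorem sum_rHat_upper {k l : Fin n} (hkl : k ≠ l) :
    ∑ i, ∑ j, F (rHat K i j k l) i j = F (invH K k l hkl) k l + F (rHat K l k k l) l k := by
  rw [← Fintype.sum_prod_type' (f := fun i j => F (rHat K i j k l) i j),
    Finset.sum_eq_add (k, l) (l, k) (by simp [hkl]) _ (by simp) (by simp), rHat_diag hkl]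
  rintro ⟨i, j⟩ - ⟨h₁, h₂⟩
  rw [rHat_eq_zero, h0]
  · rintro ⟨rfl, rfl⟩; exact h₁ rfl
  · rintro ⟨rfl, rfl⟩; exact h₂ rfl

theorem sum_rHat_upper_self (k : Fin n) :
    ∑ i, ∑ j, F (rHat K i j k k) i j = F 1 k k := by
  rw [← Fintype.sum_prod_type' (f := fun i j => F (rHat K i j k k) i j),
    Finset.sum_eq_single (k, k) _ (by simp), rHat_anti_of_le le_rfl]
  rintro ⟨i, j⟩ - h
  rw [rHat_eq_zero, h0]
  · rintro ⟨rfl, rfl⟩; exact h rfl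
  · rintro ⟨rfl, rfl⟩; exact h rfl

theorem sum_rHat_mixed {i j : Fin n} (hij : i ≠ j) :
    ∑ k, ∑ l, F (rHat K k i l j) k l = F (rHat K j i i j) j i := by
  rw [← Fintype.sum_prod_type' (f := fun k l => F (rHat K k i l j) k l),
    Finset.sum_eq_single (j, i) _ (by simp)]
  rintro ⟨k, l⟩ - h
  rw [rHat_eq_zero, h0]
  · rintro ⟨-, h⟩; exact hij h.symm
  · rintro ⟨rfl, rfl⟩; exact h rfl

theorem sum_rHat_mixed_self (i : Fin n) :
    ∑ k, ∑ l, F (rHat K k i l i) k l = ∑ k, F (rHat K k i k i) k k := by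
  refine Finset.sum_congr rfl fun k _ => ?_
  rw [Finset.sum_eq_single k _ (by simp)]
  intro l _ h
  rw [rHat_eq_zero, h0]
  · rintro ⟨rfl, -⟩; exact h rfl
  · rintro ⟨rfl, rfl⟩; exact h rfl

end RMatrix

/-! ### Translations of Ū(n) -/

section Translate

theorem translate_algebraMap (j : Fin n) (c : ℤ) (p : MvPolynomial (Fin n) K) :
    translate j c (algebraMap _ (UBar K n) p) = algebraMap _ _ (polyTranslate j c p) := by
  simp [translate, IsLocalization.map_eq]

theorem translate_algebraMap_base (j : Fin n) (c : ℤ) (a : K) :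
    translate j c (algebraMap K (UBar K n) a) = algebraMap K _ a := by
  rw [IsScalarTower.algebraMap_apply K (MvPolynomial (Fin n) K) (UBar K n), translate_algebraMap,
    AlgHom.commutes]

theorem translate_translate (j : Fin n) (c d : ℤ) (hcd : c + d = 0) (f : UBar K n) :
    translate j c (translate j d f) = f := by
  have h : (translate j c).comp (translate j d) = RingHom.id (UBar K n) := by
    refine IsLocalization.ringHom_ext (denominators K n) (MvPolynomial.ringHom_ext ?_ ?_)
    · intro a
      simp only [RingHom.comp_apply, translate_algebraMap, ← MvPolynomial.algebraMap_eq,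
        AlgHom.commutes, RingHom.id_apply]
    · intro i
      have := translate_hTilde (K := K) i j d
      simp only [hTilde] at this
      simp only [RingHom.comp_apply, RingHom.id_apply, this, map_add, map_intCast]
      have := translate_hTilde (K := K) i j c
      simp only [hTilde] at this
      rw [this, add_assoc, ← Int.cast_add]
      split_ifs <;> simp [hcd]
  exact DFunLike.congr_fun h f

end Translate

/-! ### Consequences of the defining relations -/

section Relations

variable (σ : Fin n → UBar K n)

theorem smul_eq (f : UBar K n) (v : Diff σ) : f • v = scalarHom σ f * v := rfl

theorem scalarHom_algebraMap (c : K) :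
    scalarHom σ (algebraMap K (UBar K n) c) = algebraMap K (Diff σ) c := by
  have h := quot_rel σ (Rel.scalar_algebraMap (σ := σ) c)
  rwa [AlgHom.commutes] at h

variable {σ} in
/-- An element that commutes with the `h̃ᵢ` up to a ring endomorphism does so with all of `Ū(n)`. -/
theorem scalarHom_mul_of_hTilde {y : Diff σ} {φ : UBar K n →+* UBar K n}
    (hφ : ∀ c : K, φ (algebraMap K _ c) = algebraMap K _ c)
    (h : ∀ i, scalarHom σ (hTilde i) * y = y * scalarHom σ (φ (hTilde i))) (f : UBar K n) :
    scalarHom σ f * y = y * scalarHom σ (φ f) := by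
  have hp : ∀ p : MvPolynomial (Fin n) K,
      scalarHom σ (algebraMap _ _ p) * y = y * scalarHom σ (φ (algebraMap _ _ p)) := by
    intro p
    induction p using MvPolynomial.induction_on with
    | C a =>
      rw [← MvPolynomial.algebraMap_eq, ← IsScalarTower.algebraMap_apply, hφ,
        scalarHom_algebraMap, Algebra.commutes]
    | add p q hp hq => simp only [map_add, add_mul, mul_add, hp, hq]
    | mul_X p i hp =>
      have hi := h i
      rw [hTilde] at hi
      rw [map_mul, map_mul, mul_assoc, hi, ← mul_assoc, hp, map_mul, map_mul, mul_assoc]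
  obtain ⟨p, q, rfl⟩ := IsLocalization.exists_mk'_eq (denominators K n) f
  obtain ⟨u, hu⟩ := IsLocalization.map_units (UBar K n) q
  have hf : IsLocalization.mk' (UBar K n) p q = algebraMap _ _ p * ↑u⁻¹ := by
    rw [IsLocalization.mk'_eq_iff_eq_mul, ← hu, mul_assoc, Units.inv_mul, mul_one]
  -- The rule passes from polynomials to inverses of denominators by multiplying it with the
  -- inverses on both sides.
  have hinv : scalarHom σ ↑u⁻¹ * y = y * scalarHom σ (φ ↑u⁻¹) := by
    have h1 : scalarHom σ ↑u⁻¹ * scalarHom σ ↑u = 1 := by rw [← map_mul]; simp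
    have h2 : scalarHom σ (φ ↑u) * scalarHom σ (φ ↑u⁻¹) = 1 := by rw [← map_mul, ← map_mul]; simp
    have h3 : scalarHom σ ↑u * y = y * scalarHom σ (φ ↑u) := by rw [hu]; exact hp _
    calc scalarHom σ ↑u⁻¹ * y
        = scalarHom σ ↑u⁻¹ * (y * scalarHom σ (φ ↑u)) * scalarHom σ (φ ↑u⁻¹) := by
          rw [mul_assoc, mul_assoc, h2, mul_one]
      _ = (scalarHom σ ↑u⁻¹ * scalarHom σ ↑u) * y * scalarHom σ (φ ↑u⁻¹) := by
          rw [← h3]; simp only [mul_assoc]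
      _ = _ := by rw [h1, one_mul]
  rw [hf, map_mul, mul_assoc, hinv, ← mul_assoc, hp, mul_assoc, ← map_mul, ← map_mul]

theorem scalarHom_mul_x (f : UBar K n) (j : Fin n) :
    scalarHom σ f * x σ j = x σ j * scalarHom σ (translate j 1 f) := by
  refine scalarHom_mul_of_hTilde (translate_algebraMap_base j 1) (fun i => ?_) f
  have h := quot_rel σ (Rel.weight_x (σ := σ) i j)
  rw [map_mul, map_mul, map_add] at h
  rw [translate_hTilde, map_add]
  refine h.trans (congrArg (x σ j * ·) ?_)
  change scalarHom σ (hTilde i) + _ = _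
  split_ifs <;> simp

theorem scalarHom_mul_dBar (f : UBar K n) (j : Fin n) :
    scalarHom σ f * dBar σ j = dBar σ j * scalarHom σ (translate j (-1) f) := by
  refine scalarHom_mul_of_hTilde (translate_algebraMap_base j (-1)) (fun i => ?_) f
  have h := quot_rel σ (Rel.weight_d (σ := σ) i j)
  rw [map_mul, map_mul, map_sub] at h
  rw [translate_hTilde, map_add]
  refine h.trans (congrArg (dBar σ j * ·) ?_)
  change scalarHom σ (hTilde i) - _ = _
  split_ifs <;> simp [sub_eq_add_neg]

theorem x_mul_scalarHom (f : UBar K n) (j : Fin n) :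
    x σ j * scalarHom σ f = scalarHom σ (translate j (-1) f) * x σ j := by
  rw [scalarHom_mul_x, translate_translate j 1 (-1) (by simp)]

theorem dBar_mul_scalarHom (f : UBar K n) (j : Fin n) :
    dBar σ j * scalarHom σ f = scalarHom σ (translate j 1 f) * dBar σ j := by
  rw [scalarHom_mul_dBar, translate_translate j (-1) 1 (by simp)]

/-- With a = h̃ᵢⱼ, clearing denominators gives (a-1)a xⁱxʲ = (a-1)(a+1) xʲxⁱ, and a - 1 is a unit.
-/
theorem x_mul_x {i j : Fin n} (hij : i < j) :
    scalarHom σ (hTilde i - hTilde j) * (x σ i * x σ j) =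
      scalarHom σ (hTilde i - hTilde j + 1) * (x σ j * x σ i) := by
  have h := quot_rel σ (Rel.x_x (σ := σ) i j)
  simp only [map_mul, map_sum] at h
  change x σ i * x σ j = ∑ k, ∑ l, scalarHom σ (rHat K i j k l) * x σ k * x σ l at h
  rw [sum_rHat_lower (fun f k l => scalarHom σ f * x σ k * x σ l) (by simp) hij.ne,
    rHat_anti_of_lt hij] at h
  have hu : IsUnit (scalarHom σ (hTilde i - hTilde j - 1)) := by
    simpa [sub_eq_add_neg] using (isUnit_hTilde_sub_add (K := K) hij.ne (-1)).map (scalarHom σ)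
  have hi := sub_mul_invH (K := K) hij.ne
  set a : UBar K n := hTilde i - hTilde j
  set b := invH K i j hij.ne
  simp only [mul_assoc] at h
  refine hu.mul_left_cancel ?_
  rw [← mul_assoc (scalarHom σ _) (scalarHom σ _), ← map_mul,
    ← mul_assoc (scalarHom σ _) (scalarHom σ _), ← map_mul]
  have h2 := congrArg (fun v => scalarHom σ (a ^ 2) * v) h
  simp only [mul_add] at h2
  rw [← mul_assoc (scalarHom σ _) (scalarHom σ _), ← map_mul,
    ← mul_assoc (scalarHom σ _) (scalarHom σ _), ← map_mul] at h2
  rw [show a ^ 2 * b = a by linear_combination a * hi,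
    show a ^ 2 * ((a ^ 2 - 1) * b ^ 2) = (a - 1) * (a + 1) by
      linear_combination (a ^ 2 - 1) * (a * b + 1) * hi] at h2
  rw [← sub_eq_iff_eq_add', ← sub_mul, ← map_sub] at h2
  rw [← h2]
  congr 2
  ring

theorem exists_x_mul_x (i j : Fin n) :
    ∃ c, x σ i * x σ j = scalarHom σ c * (x σ j * x σ i) := by
  have key : ∀ {i j : Fin n} {a b : UBar K n}, IsUnit a →
      scalarHom σ a * (x σ i * x σ j) = scalarHom σ b * (x σ j * x σ i) →
      ∃ c, x σ i * x σ j = scalarHom σ c * (x σ j * x σ i) := by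
    rintro i j _ b ⟨u, rfl⟩ h
    refine ⟨↑u⁻¹ * b, ?_⟩
    rw [map_mul, mul_assoc, ← h, ← mul_assoc, ← map_mul, Units.inv_mul, map_one, one_mul]
  rcases lt_trichotomy i j with h | rfl | h
  · exact key (isUnit_hTilde_sub h.ne) (x_mul_x σ h)
  · exact ⟨1, by simp⟩
  · refine key ?_ (x_mul_x σ h).symm
    simpa using isUnit_hTilde_sub_add (K := K) h.ne 1

theorem dBar_mul_dBar {k l : Fin n} (hkl : k < l) :
    dBar σ l * dBar σ k * scalarHom σ (hTilde k - hTilde l - 1) =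
      dBar σ k * dBar σ l * scalarHom σ (hTilde k - hTilde l) := by
  have h := quot_rel σ (Rel.d_d (σ := σ) k l)
  simp only [map_mul, map_sum] at h
  change dBar σ l * dBar σ k =
    ∑ i, ∑ j, dBar σ j * dBar σ i * scalarHom σ (rHat K i j k l) at h
  rw [sum_rHat_upper (fun f i j => dBar σ j * dBar σ i * scalarHom σ f) (by simp) hkl.ne,
    rHat_anti_of_le hkl.le, map_one, mul_one] at h
  have hi := sub_mul_invH (K := K) hkl.ne
  have h2 := congrArg (fun v => v * scalarHom σ (hTilde k - hTilde l)) h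
  simp only [add_mul, mul_assoc, ← map_mul] at h2
  rw [mul_comm (invH K k l hkl.ne), hi, ← sub_eq_iff_eq_add'] at h2
  simp only [mul_assoc]
  rw [← h2, map_sub, map_one, mul_sub, mul_sub]

theorem exists_dBar_mul_dBar (i j : Fin n) :
    ∃ c, dBar σ i * dBar σ j = scalarHom σ c * (dBar σ j * dBar σ i) := by
  have key : ∀ {i j : Fin n} {a b : UBar K n}, IsUnit a →
      dBar σ i * dBar σ j * scalarHom σ a = dBar σ j * dBar σ i * scalarHom σ b →
      ∃ c, dBar σ i * dBar σ j = scalarHom σ c * (dBar σ j * dBar σ i) := by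
    rintro i j _ b ⟨u, rfl⟩ h
    refine ⟨translate j 1 (translate i 1 (b * ↑u⁻¹)), ?_⟩
    rw [← mul_assoc, ← dBar_mul_scalarHom, mul_assoc, ← dBar_mul_scalarHom, ← mul_assoc,
      map_mul, ← mul_assoc, ← h, mul_assoc, ← map_mul, Units.mul_inv, map_one, mul_one]
  rcases lt_trichotomy i j with h | rfl | h
  · exact key (isUnit_hTilde_sub h.ne) (dBar_mul_dBar σ h).symm
  · exact ⟨1, by simp⟩
  · refine key ?_ (dBar_mul_dBar σ h)
    simpa [sub_eq_add_neg] using isUnit_hTilde_sub_add (K := K) h.ne (-1)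

theorem x_mul_dBar (i j : Fin n) :
    x σ i * dBar σ j =
      (∑ k, ∑ l, dBar σ k * scalarHom σ (rHat K k i l j) * x σ l) -
        if i = j then scalarHom σ (σ i) else 0 := by
  have h := quot_rel σ (Rel.x_d (σ := σ) i j)
  simp only [map_mul, map_sum, map_sub] at h
  refine h.trans ?_
  split_ifs <;> simp [x, dBar, scalarHom]

theorem x_mul_dBar_of_ne {i j : Fin n} (hij : i ≠ j) :
    x σ i * dBar σ j = dBar σ j * scalarHom σ (rHat K j i i j) * x σ i := by
  rw [x_mul_dBar, sum_rHat_mixed (fun f k l => dBar σ k * scalarHom σ f * x σ l) (by simp) hij]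
  simp [hij]

theorem x_mul_dBar_self (i : Fin n) :
    x σ i * dBar σ i =
      (∑ k, dBar σ k * scalarHom σ (rHat K k i k i) * x σ k) - scalarHom σ (σ i) := by
  rw [x_mul_dBar, sum_rHat_mixed_self (fun f k l => dBar σ k * scalarHom σ f * x σ l) (by simp)]
  simp

end Relations

/-! ### The ordered monomials span -/

section Spanning

variable (σ : Fin n → UBar K n)

theorem exists_x_mul_orderedMonomial (a : Fin n) (k : Fin n → ℕ) :
    ∃ c, x σ a * orderedMonomial (x σ) k =
      scalarHom σ c * orderedMonomial (x σ) (k + Pi.single a 1) :=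
  exists_mul_orderedMonomial (scalarHom σ) (x σ) (fun a f => ⟨_, x_mul_scalarHom σ f a⟩)
    (exists_x_mul_x σ) a k

theorem exists_dBar_mul_orderedMonomial (a : Fin n) (k : Fin n → ℕ) :
    ∃ c, dBar σ a.rev * orderedMonomial (fun a : Fin n => dBar σ a.rev) k =
      scalarHom σ c * orderedMonomial (fun a : Fin n => dBar σ a.rev) (k + Pi.single a 1) :=
  exists_mul_orderedMonomial (scalarHom σ) (fun a : Fin n => dBar σ a.rev)
    (fun a f => ⟨_, dBar_mul_scalarHom σ f a.rev⟩) (fun _ _ => exists_dBar_mul_dBar σ _ _) a k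

theorem exists_dBar_mul_generators (a : Fin n) (k : Fin (n + n) → ℕ) :
    ∃ c, dBar σ a.rev * orderedMonomial (generators σ) k =
      scalarHom σ c * orderedMonomial (generators σ) (k + Pi.single (Fin.castAdd n a) 1) := by
  obtain ⟨c, hc⟩ := exists_dBar_mul_orderedMonomial σ a fun b => k (Fin.castAdd n b)
  refine ⟨c, ?_⟩
  rw [generators, orderedMonomial_append, orderedMonomial_append, ← mul_assoc, hc, mul_assoc]
  congr 3
  · ext b
    simp [Pi.single_apply]
  · ext b
    have : Fin.natAdd n b ≠ Fin.castAdd n a := by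
      intro h; have := congrArg Fin.val h; simp at this; omega
    rw [Pi.add_apply, Pi.single_eq_of_ne this, add_zero]

theorem span_orderedMonomial_generators :
    Submodule.span (UBar K n) (Set.range (orderedMonomial (generators σ))) = ⊤ := by
  set W := Submodule.span (UBar K n) (Set.range (orderedMonomial (generators σ))) with hW
  have hd : ∀ j, ∀ v ∈ W, dBar σ j * v ∈ W := by
    intro j v hv
    induction hv using Submodule.span_induction with
    | mem v hv =>
      obtain ⟨k, rfl⟩ := hv
      obtain ⟨c, hc⟩ := exists_dBar_mul_generators σ j.rev k
      rw [Fin.rev_rev] at hc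
      rw [hc]
      exact W.smul_mem c (Submodule.subset_span ⟨_, rfl⟩)
    | zero => simp
    | add u v _ _ hu hv => rw [mul_add]; exact W.add_mem hu hv
    | smul f v _ hv =>
      rw [smul_eq, ← mul_assoc, dBar_mul_scalarHom, mul_assoc]
      exact W.smul_mem _ hv
  have hxmon : ∀ k, orderedMonomial (x σ) k ∈ W := by
    intro k
    refine Submodule.subset_span ⟨Fin.append 0 k, ?_⟩
    rw [generators, orderedMonomial_append]
    simp only [Fin.append_left, Fin.append_right]
    rw [show (fun a : Fin n => (0 : Fin n → ℕ) a) = 0 from rfl, orderedMonomial_zero, one_mul]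
  have hx : ∀ v ∈ W, ∀ i, x σ i * v ∈ W := by
    intro v hv
    induction hv using Submodule.span_induction with
    | mem v hv =>
      obtain ⟨k, rfl⟩ := hv
      rw [generators, orderedMonomial_append]
      -- Membership of v itself is carried along because moving xⁱ past ∂̄ᵢ also produces the term
      -- σᵢv.
      refine (orderedMonomial_mul_induction (fun a : Fin n => dBar σ a.rev)
        (fun v => v ∈ W ∧ ∀ i, x σ i * v ∈ W) ?_ _ _ ⟨hxmon _, fun i => ?_⟩).2
      · rintro a v ⟨hv, hxv⟩
        refine ⟨hd _ _ hv, fun i => ?_⟩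
        rw [← mul_assoc, x_mul_dBar, sub_mul, Finset.sum_mul]
        refine W.sub_mem (W.sum_mem fun k _ => ?_) ?_
        · rw [Finset.sum_mul]
          refine W.sum_mem fun l _ => ?_
          rw [mul_assoc, mul_assoc]
          exact hd _ _ (W.smul_mem _ (hxv l))
        · split_ifs
          · exact W.smul_mem _ hv
          · simp
      · obtain ⟨c, hc⟩ := exists_x_mul_orderedMonomial σ i fun a => k (Fin.natAdd n a)
        rw [hc]
        exact W.smul_mem c (hxmon _)
    | zero => simp
    | add u v _ _ hu hv => intro i; rw [mul_add]; exact W.add_mem (hu i) (hv i)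
    | smul f v _ hv =>
      intro i
      rw [smul_eq, ← mul_assoc, x_mul_scalarHom, mul_assoc]
      exact W.smul_mem _ (hv i)
  have hall : ∀ p : Words K n, ∀ v ∈ W, quot σ p * v ∈ W := by
    intro p
    induction p using FreeAlgebra.induction with
    | grade0 c =>
      intro v hv
      rw [AlgHom.commutes, ← scalarHom_algebraMap]
      exact W.smul_mem _ hv
    | grade1 a =>
      intro v hv
      cases a with
      | scalar f => exact W.smul_mem f hv
      | x i => exact hx v hv i
      | d i => exact hd i v hv
    | mul p q hp hq => intro v hv; rw [map_mul, mul_assoc]; exact hp _ (hq _ hv)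
    | add p q hp hq => intro v hv; rw [map_add, add_mul]; exact W.add_mem (hp _ hv) (hq _ hv)
  rw [eq_top_iff]
  intro v _
  obtain ⟨p, rfl⟩ := RingQuot.mkAlgHom_surjective K (Rel σ) v
  have h1 : (1 : Diff σ) ∈ W := by
    have := hxmon 0
    rwa [orderedMonomial_zero] at this
  have := hall p 1 h1
  rwa [mul_one] at this

end Spanning

/-! ### Necessity of the difference equations -/

section Necessity

variable {σ : Fin n → UBar K n}

theorem delta_eq_of_hasPBW (h : HasPBW (UBar K n) (generators σ)) (i j : Fin n) :
    (hTilde i - hTilde j) * delta j (σ i) = σ i - σ j := by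
  obtain ⟨b, hb⟩ := h
  rcases eq_or_ne i j with rfl | hij
  · simp
  let e : Fin (n + n) → ℕ := Pi.single (Fin.natAdd n j) 1
  let coeff : Diff σ →ₗ[UBar K n] UBar K n := b.coord e
  have hs : ∀ f v, coeff (scalarHom σ f * v) = f * coeff v := fun f v => coeff.map_smul f v
  have hx : coeff (x σ j) = 1 := by
    have : x σ j = b e := by
      rw [hb]
      exact ((orderedMonomial_single _ _).trans (Fin.append_right _ _ _)).symm
    rw [this]; simp [coeff]
  -- Left multiplication by ∂̄ₖ raises its exponent in a basis monomial, so xʲ can no longer occur.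
  have hd : ∀ k v, coeff (dBar σ k * v) = 0 := by
    intro k v
    induction b.mem_span v using Submodule.span_induction with
    | zero => simp
    | add u v _ _ hu hv => rw [mul_add, map_add, hu, hv, add_zero]
    | smul f v _ hv => rw [smul_eq, ← mul_assoc, dBar_mul_scalarHom, mul_assoc, hs, hv, mul_zero]
    | mem v hv =>
      obtain ⟨m, rfl⟩ := hv
      obtain ⟨c, hc⟩ := exists_dBar_mul_generators σ k.rev m
      rw [Fin.rev_rev] at hc
      have hb' : ∀ m, b m = orderedMonomial (generators σ) m := hb
      rw [hb', hc, hs, ← hb']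
      have hne : m + Pi.single (Fin.castAdd n k.rev) 1 ≠ e := by
        intro h
        have h1 := congrFun h (Fin.castAdd n k.rev)
        have h2 : Fin.castAdd n k.rev ≠ Fin.natAdd n j := by
          intro h; have := congrArg Fin.val h; simp at this; omega
        rw [Pi.add_apply, Pi.single_eq_same,
          show e (Fin.castAdd n k.rev) = 0 from Pi.single_eq_of_ne h2 _] at h1
        omega
      simp [coeff, hne]
  have hself : ∀ i v, coeff (x σ i * dBar σ i * v) = - (σ i * coeff v) := by
    intro i v
    rw [x_mul_dBar_self, sub_mul, map_sub, Finset.sum_mul, map_sum, hs,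
      Finset.sum_eq_zero fun k _ => by rw [mul_assoc, mul_assoc, hd], zero_sub]
  have hcomm : ∀ i f v, x σ i * dBar σ i * (scalarHom σ f * v) =
      scalarHom σ f * (x σ i * dBar σ i * v) := by
    intro i f v
    rw [← mul_assoc, mul_assoc (x σ i), dBar_mul_scalarHom, ← mul_assoc, x_mul_scalarHom,
      translate_translate i (-1) 1 (by simp)]
    simp only [mul_assoc]
  -- In the expansion of xⁱ∂̄ᵢ, the terms that survive are the one with ∂̄ⱼ, where xʲ∂̄ⱼ contributes
  -- -σⱼ, and -σᵢ, which xʲ translates.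
  have hleft : coeff (x σ j * x σ i * dBar σ i) =
      - (σ j * invH K j i hij.symm) - translate j (-1) (σ i) := by
    rw [mul_assoc, x_mul_dBar_self, mul_sub, map_sub, x_mul_scalarHom, hs, hx, mul_one,
      Finset.mul_sum, map_sum, Finset.sum_eq_single j _ (by simp)]
    · rw [mul_assoc, ← mul_assoc, hself, hs, hx, mul_one, rHat_diag hij.symm]
    · intro k _ hk
      rw [mul_assoc, ← mul_assoc, x_mul_dBar_of_ne σ hk.symm, mul_assoc, mul_assoc, hd]
  have hright : coeff (x σ i * x σ j * dBar σ i) = - (rHat K i j j i * σ i) := by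
    rw [mul_assoc, x_mul_dBar_of_ne σ hij.symm, mul_assoc, ← mul_assoc, hcomm, hs, hself, hx]
    ring
  have hi := sub_mul_invH (K := K) hij.symm
  have hi' := sub_mul_invH (K := K) hij
  rw [delta]
  rcases hij.lt_or_gt with hlt | hlt
  · have h := congrArg (fun v => coeff (v * dBar σ i)) (x_mul_x σ hlt)
    simp only [mul_assoc (scalarHom σ _), hs] at h
    rw [hleft, hright, rHat_anti_of_lt hlt] at h
    -- For i < j the entry (h̃ᵢⱼ² - 1)/h̃ᵢⱼ² puts a factor h̃ᵢⱼ + 1 on both sides.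
    have hu : IsUnit (hTilde i - hTilde j + 1 : UBar K n) := by
      simpa using isUnit_hTilde_sub_add (K := K) hij 1
    refine hu.mul_left_cancel ?_
    set a : UBar K n := hTilde i
    set a' : UBar K n := hTilde j
    set c := invH K j i hij.symm
    set c' := invH K i j hij
    linear_combination -(a - a') * h - (a - a' + 1) * σ j * hi -
      (a - a' + 1) * (a - a' - 1) * ((a - a') * c' + 1) * σ i * hi'
  · have h := congrArg (fun v => coeff (v * dBar σ i)) (x_mul_x σ hlt)
    simp only [mul_assoc (scalarHom σ _), hs] at h
    rw [hleft, hright, rHat_anti_of_le hlt.le] at h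
    set a : UBar K n := hTilde i
    set a' : UBar K n := hTilde j
    set c := invH K j i hij.symm
    linear_combination -h - σ j * hi

end Necessity

end HDeformed
end

noncomputable section
namespace HDeformed

/-! ### Affine substitutions in F[Γ₁, …, Γₙ] -/

section ShiftHom

open MvPolynomial

theorem algHom_apply_eq {K F : Type*} [Field K] [Field F] [Algebra K F] {n : ℕ}
    {φ ψ : MvPolynomial (Fin n) F →ₐ[K] MvPolynomial (Fin n) F}
    (hC : ∀ f, φ (C f) = ψ (C f)) (hX : ∀ k, φ (X k) = ψ (X k)) (v : MvPolynomial (Fin n) F) :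
    φ v = ψ v := by
  have : (φ : MvPolynomial (Fin n) F →+* MvPolynomial (Fin n) F) = ψ :=
    MvPolynomial.ringHom_ext hC hX
  exact DFunLike.congr_fun this v

theorem totalDegree_C_mul_X_le {F : Type*} [Field F] {n : ℕ} (a : F) (k : Fin n) :
    (C a * X k : MvPolynomial (Fin n) F).totalDegree ≤ 1 := by
  refine (totalDegree_mul _ _).trans ?_
  rw [totalDegree_C, totalDegree_X]

variable {K F : Type*} [Field K] [Field F] [Algebra K F] {n : ℕ} (h : Fin n → F)

/-- The affine form `c ∑ₖ Γₖ / (hₖ - hᵢ + c) - u`. -/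
def shiftForm (i : Fin n) (c u : F) : MvPolynomial (Fin n) F :=
  ∑ k, C (c * (h k - h i + c)⁻¹) * X k - C u

/-- The `K`-algebra endomorphism of `F[Γ₁, …, Γₙ]` that extends the automorphism `t` of `F`,
multiplies `Γₖ`, `k ≠ i`, by a scalar and sends `Γᵢ` to `shiftForm h i c u`. -/
def shiftHom (t : F ≃ₐ[K] F) (i : Fin n) (c u : F) :
    MvPolynomial (Fin n) F →ₐ[K] MvPolynomial (Fin n) F :=
  { eval₂Hom (C.comp (t : F →+* F)) fun k =>
      -- At k = i the first coefficient is zero, so sums over k need no case distinction.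
      C ((h k - h i) * (h k - h i + c)⁻¹) * X k + if k = i then shiftForm h i c u else 0 with
    commutes' := fun r => by
      simp [IsScalarTower.algebraMap_apply K F (MvPolynomial (Fin n) F),
        MvPolynomial.algebraMap_eq] }

variable (t : F ≃ₐ[K] F) (i : Fin n) (c u : F)

@[simp]
theorem shiftHom_C (f : F) : shiftHom h t i c u (C f) = C (t f) := by
  simp [shiftHom]

theorem shiftHom_X (k : Fin n) : shiftHom h t i c u (X k) =
    C ((h k - h i) * (h k - h i + c)⁻¹) * X k + if k = i then shiftForm h i c u else 0 := by
  simp [shiftHom]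

theorem shiftHom_X_of_ne {k : Fin n} (hk : k ≠ i) : shiftHom h t i c u (X k) =
    C ((h k - h i) * (h k - h i + c)⁻¹) * X k := by
  simp [shiftHom_X, hk]

theorem shiftHom_X_self : shiftHom h t i c u (X i) = shiftForm h i c u := by
  simp [shiftHom_X]

theorem shiftHom_sum (f : Fin n → F) : shiftHom h t i c u (∑ k, C (f k) * X k) =
    ∑ k, C (t (f k) * ((h k - h i) * (h k - h i + c)⁻¹)) * X k +
      C (t (f i)) * shiftForm h i c u := by
  simp only [map_sum, map_mul, shiftHom_C, shiftHom_X, mul_add, Finset.sum_add_distrib, mul_assoc]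
  simp

variable {h t i c u}

/-- The inverse substitution has the same shape, with c replaced by -c; taking c = ±1 gives both
composites of `tau i` and its inverse. -/
theorem shiftHom_shiftHom {t' : F ≃ₐ[K] F} {u' : F} (htt : ∀ f, t (t' f) = f) (hc : c ^ 2 = 1)
    (ht : ∀ j, t (h j) = h j - if j = i then c else 0) (htc : t c = c) (hu : t u' = - u)
    (h0 : ∀ k, k ≠ i → h k - h i ≠ 0) (h1 : ∀ k, h k - h i + c ≠ 0)
    (v : MvPolynomial (Fin n) F) :
    shiftHom h t i c u (shiftHom h t' i (-c) u' v) = v := by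
  have hc0 : c ≠ 0 := by rintro rfl; simp at hc
  have htk : ∀ k, k ≠ i → t (h k - h i + -c) = h k - h i := by
    intro k hk
    simp only [map_add, map_sub, map_neg, ht, hk, htc, if_true, if_false]
    ring
  refine algHom_apply_eq (φ := (shiftHom h t i c u).comp (shiftHom h t' i (-c) u'))
    (ψ := AlgHom.id K _) (fun f => ?_) (fun k => ?_) v
  · simp [htt]
  · change shiftHom h t i c u (shiftHom h t' i (-c) u' (X k)) = X k
    by_cases hk : k = i
    · subst hk
      rw [shiftHom_X_self, shiftForm, map_sub, shiftHom_sum, shiftHom_C, hu]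
      have h2 : t (-c * (h k - h k + -c)⁻¹) = 1 := by
        rw [sub_self, zero_add, mul_inv_cancel₀ (neg_ne_zero.mpr hc0), map_one]
      rw [h2, C_1, one_mul, shiftForm, map_neg]
      -- The coefficients of Γⱼ from the two affine forms cancel for j ≠ k; at j = k the first
      -- vanishes and the second is c/c = 1.
      have h3 : ∀ j, C (t (-c * (h j - h k + -c)⁻¹) * ((h j - h k) * (h j - h k + c)⁻¹)) * X j +
          C (c * (h j - h k + c)⁻¹) * X j = if j = k then (X k : MvPolynomial (Fin n) F) else 0 := by
        intro j
        rw [← add_mul, ← C_add]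
        split_ifs with hj
        · subst hj
          simp [hc0]
        · rw [map_mul, map_inv₀, htk j hj, map_neg, htc]
          have h4 : -c * (h j - h k)⁻¹ * ((h j - h k) * (h j - h k + c)⁻¹) +
              c * (h j - h k + c)⁻¹ = 0 := by
            have := h0 j hj
            have := h1 j
            field_simp
            ring
          rw [h4, C_0, zero_mul]
      have h5 := Finset.sum_congr (rfl : (Finset.univ : Finset (Fin n)) = _) fun j _ => h3 j
      rw [Finset.sum_add_distrib, Finset.sum_ite_eq' ] at h5
      simp only [Finset.mem_univ, if_true] at h5
      rw [← h5]
      ring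
    · rw [shiftHom_X_of_ne _ _ _ _ _ hk, map_mul, shiftHom_C, shiftHom_X_of_ne _ _ _ _ _ hk,
        ← mul_assoc, ← C_mul, map_mul t, map_inv₀, htk k hk]
      have h4 : t (h k - h i) = h k - h i + c := by
        simp only [map_sub, ht, hk, if_true, if_false]; ring
      rw [h4]
      have h5 : (h k - h i + c) * (h k - h i)⁻¹ * ((h k - h i) * (h k - h i + c)⁻¹) = 1 := by
        have := h0 k hk
        have := h1 k
        field_simp
      rw [h5, C_1, one_mul]

/-- `shiftHom` does not raise the degree. -/
theorem totalDegree_shiftHom_le (v : MvPolynomial (Fin n) F) :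
    (shiftHom h t i c u v).totalDegree ≤ v.totalDegree := by
  have hform : (shiftForm h i c u).totalDegree ≤ 1 := by
    refine (totalDegree_sub _ _).trans (max_le ?_ (by simp))
    refine (totalDegree_finsetSum _ _).trans (Finset.sup_le fun k _ => ?_)
    exact totalDegree_C_mul_X_le _ _
  have hX : ∀ k, (shiftHom h t i c u (X k)).totalDegree ≤ 1 := by
    intro k
    by_cases hk : k = i
    · rw [hk, shiftHom_X_self]; exact hform
    · rw [shiftHom_X_of_ne _ _ _ _ _ hk]
      exact totalDegree_C_mul_X_le _ _
  conv_lhs => rw [v.as_sum, map_sum]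
  refine (totalDegree_finsetSum _ _).trans (Finset.sup_le fun e he => ?_)
  refine le_trans ?_ (le_totalDegree he)
  rw [monomial_eq, map_mul, shiftHom_C, Finsupp.prod, map_prod]
  refine (totalDegree_mul _ _).trans ?_
  rw [totalDegree_C, zero_add]
  refine (totalDegree_finsetProd _ _).trans (Finset.sum_le_sum fun k _ => ?_)
  rw [map_pow]
  refine (totalDegree_pow _ _).trans ?_
  simpa using Nat.mul_le_mul_left (e k) (hX k)

end ShiftHom

end HDeformed
end

/-! ### The operators xⁱ and ∂̄ᵢ over a shifted field -/

noncomputable section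
namespace HDeformed

/-- A field with commuting automorphisms `tᵢ` that shift elements `hⱼ`, and a solution `s` of the
finite difference equations `(hᵢ - hⱼ) (sᵢ - tⱼ sᵢ) = sᵢ - sⱼ`. -/
structure ShiftedField (K F : Type*) [Field K] [Field F] [Algebra K F] (n : ℕ) where
  /-- the shifted elements -/
  h : Fin n → F
  /-- the shifts -/
  t : Fin n → F ≃ₐ[K] F
  /-- the solution of the difference equations -/
  s : Fin n → F
  t_h : ∀ i j, t i (h j) = h j - if j = i then 1 else 0
  h_ne : ∀ i j, i ≠ j → ∀ c : ℤ, h i - h j + c ≠ 0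
  t_comm : ∀ i j f, t i (t j f) = t j (t i f)
  t_s : ∀ i j, (h i - h j) * (s i - t j (s i)) = s i - s j

namespace ShiftedField

open MvPolynomial

variable {K F : Type*} [Field K] [Field F] [Algebra K F] {n : ℕ} (S : ShiftedField K F n)

theorem sub_ne {i j : Fin n} (hij : i ≠ j) : S.h i - S.h j ≠ 0 := by
  simpa using S.h_ne i j hij 0

theorem sub_add_ne (i j : Fin n) : S.h i - S.h j + 1 ≠ 0 := by
  rcases eq_or_ne i j with rfl | hij
  · simp
  · simpa using S.h_ne i j hij 1

theorem sub_sub_ne (i j : Fin n) : S.h i - S.h j - 1 ≠ 0 := by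
  rcases eq_or_ne i j with rfl | hij
  · simp
  · simpa [sub_eq_add_neg] using S.h_ne i j hij (-1)

theorem t_symm_h (i j : Fin n) : (S.t i).symm (S.h j) = S.h j + if j = i then 1 else 0 := by
  rw [AlgEquiv.symm_apply_eq, map_add, S.t_h]
  split_ifs <;> simp

theorem shiftHom_shiftHom_symm (i : Fin n) (v : MvPolynomial (Fin n) F) :
    shiftHom S.h (S.t i) i 1 (S.s i)
      (shiftHom S.h (S.t i).symm i (-1) (-(S.t i).symm (S.s i)) v) = v := by
  refine shiftHom_shiftHom (fun f => ?_) (one_pow 2) (S.t_h i) (map_one _) ?_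
    (fun k hk => S.sub_ne hk) (fun k => S.sub_add_ne k i) v
  · exact (S.t i).apply_symm_apply f
  · rw [map_neg, AlgEquiv.apply_symm_apply]

theorem shiftHom_symm_shiftHom (i : Fin n) (v : MvPolynomial (Fin n) F) :
    shiftHom S.h (S.t i).symm i (-1) (-(S.t i).symm (S.s i))
      (shiftHom S.h (S.t i) i 1 (S.s i) v) = v := by
  have key := shiftHom_shiftHom (h := S.h) (t := (S.t i).symm) (t' := S.t i) (i := i) (c := -1)
    (u := -(S.t i).symm (S.s i)) (u' := S.s i) (S.t i).symm_apply_apply (by norm_num)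
    (fun j => by rw [S.t_symm_h]; split_ifs <;> simp) (by rw [map_neg, map_one])
    (by rw [neg_neg]) (fun k hk => S.sub_ne hk)
    (fun k => by rw [← sub_eq_add_neg]; exact S.sub_sub_ne k i) v
  rwa [neg_neg] at key

/-- The automorphism of `F[Γ₁, …, Γₙ]` by which `xⁱ` acts up to a scalar. -/
def tau (i : Fin n) : MvPolynomial (Fin n) F ≃ₐ[K] MvPolynomial (Fin n) F :=
  { shiftHom S.h (S.t i) i 1 (S.s i) with
    invFun := shiftHom S.h (S.t i).symm i (-1) (-(S.t i).symm (S.s i))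
    left_inv := S.shiftHom_symm_shiftHom i
    right_inv := S.shiftHom_shiftHom_symm i }

theorem tau_apply (i : Fin n) (v : MvPolynomial (Fin n) F) :
    S.tau i v = shiftHom S.h (S.t i) i 1 (S.s i) v := rfl

theorem tau_symm_apply (i : Fin n) (v : MvPolynomial (Fin n) F) :
    (S.tau i).symm v = shiftHom S.h (S.t i).symm i (-1) (-(S.t i).symm (S.s i)) v := rfl

theorem tau_C (i : Fin n) (f : F) : S.tau i (C f) = C (S.t i f) := by
  simp [tau_apply]

theorem tau_symm_C (i : Fin n) (f : F) : (S.tau i).symm (C f) = C ((S.t i).symm f) := by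
  simp [tau_symm_apply]

theorem tau_X_of_ne {i k : Fin n} (hk : k ≠ i) :
    S.tau i (X k) = C ((S.h k - S.h i) * (S.h k - S.h i + 1)⁻¹) * X k := by
  rw [tau_apply, shiftHom_X_of_ne _ _ _ _ _ hk]

theorem tau_symm_X_of_ne {i k : Fin n} (hk : k ≠ i) :
    (S.tau i).symm (X k) = C ((S.h k - S.h i) * (S.h k - S.h i - 1)⁻¹) * X k := by
  rw [tau_symm_apply, shiftHom_X_of_ne _ _ _ _ _ hk, sub_eq_add_neg _ (1 : F)]

theorem tau_X_self (i : Fin n) :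
    S.tau i (X i) = ∑ k, C (S.h k - S.h i + 1)⁻¹ * X k - C (S.s i) := by
  rw [tau_apply, shiftHom_X_self, shiftForm]
  simp

/-- The coefficients of the Γₖ agree by partial fractions. The constant terms agree by `t_s`; this
is where the difference equations enter. -/
theorem tau_tau_X_self {i j : Fin n} (hij : i ≠ j) :
    S.tau j (S.tau i (X i)) =
      C ((S.h i - S.h j - 1) * (S.h i - S.h j)⁻¹) * S.tau i (X i) := by
  have hj : S.t j (S.h j - S.h i + 1)⁻¹ = (S.h j - S.h i)⁻¹ := by
    simp only [map_inv₀, map_add, map_sub, map_one, S.t_h, hij, if_true, if_false]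
    congr 1; ring
  rw [tau_X_self, map_sub, tau_C, tau_apply, shiftHom_sum, hj, shiftForm, mul_sub, mul_sub,
    Finset.mul_sum, Finset.mul_sum, ← C_mul, ← C_mul, ← add_sub_assoc, ← Finset.sum_add_distrib,
    sub_sub, ← C_add]
  have h1 := S.sub_ne hij
  have h2 := S.sub_ne hij.symm
  congr 1
  · refine Finset.sum_congr rfl fun k _ => ?_
    rw [← mul_assoc (C _) (C _), ← C_mul, ← add_mul, ← C_add, ← mul_assoc (C _) (C _), ← C_mul]
    congr 2
    have h3 := S.sub_add_ne k i
    have h4 := S.sub_add_ne k j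
    rcases eq_or_ne k j with rfl | hk
    · rw [hj]
      have : S.h i - S.h k = -(S.h k - S.h i) := by ring
      simp only [sub_self, mul_zero, zero_add, inv_one, mul_one]
      rw [this]
      field_simp
      ring
    · have : S.t j (S.h k - S.h i + 1)⁻¹ = (S.h k - S.h i + 1)⁻¹ := by
        simp [S.t_h, hk, hij]
      rw [this, one_mul]
      have e : (S.h j - S.h i)⁻¹ = -(S.h i - S.h j)⁻¹ := by rw [← inv_neg, neg_sub]
      rw [e]
      field_simp
      ring
  · congr 1
    have := S.t_s i j
    have e : (S.h j - S.h i)⁻¹ = -(S.h i - S.h j)⁻¹ := by rw [← inv_neg, neg_sub]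
    rw [e]
    field_simp
    linear_combination -this

theorem tau_comm (i j : Fin n) (v : MvPolynomial (Fin n) F) :
    S.tau i (S.tau j v) = S.tau j (S.tau i v) := by
  rcases eq_or_ne i j with rfl | hij
  · rfl
  have key : ∀ {i j : Fin n}, i ≠ j → S.tau i (S.tau j (X j)) = S.tau j (S.tau i (X j)) := by
    intro i j hij
    rw [S.tau_tau_X_self hij.symm, S.tau_X_of_ne hij.symm, map_mul (S.tau j), tau_C]
    congr 2
    simp only [map_mul, map_inv₀, map_add, map_sub, map_one, S.t_h, hij, if_true, if_false]
    congr 1 <;> ring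
  refine algHom_apply_eq (φ := ((S.tau j).trans (S.tau i)).toAlgHom)
    (ψ := ((S.tau i).trans (S.tau j)).toAlgHom) (fun f => ?_) (fun k => ?_) v
  · change S.tau i (S.tau j (C f)) = S.tau j (S.tau i (C f))
    simp only [tau_C, S.t_comm i j]
  · change S.tau i (S.tau j (X k)) = S.tau j (S.tau i (X k))
    rcases eq_or_ne k j with rfl | hkj
    · exact key hij
    rcases eq_or_ne k i with rfl | hki
    · exact (key hij.symm).symm
    rw [S.tau_X_of_ne hki, S.tau_X_of_ne hkj, map_mul (S.tau i), map_mul (S.tau j), tau_C, tau_C,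
      S.tau_X_of_ne hki, S.tau_X_of_ne hkj, mul_left_comm]
    simp only [map_mul (S.t _), map_inv₀, map_add (S.t _), map_sub (S.t _), map_one, S.t_h, hkj, hki,
      hij, hij.symm, if_false, sub_zero]

/-- The scalar by which `xⁱ` differs from `tau i`. -/
def scale (i : Fin n) : F := ∏ m ∈ Finset.Iio i, (S.h i - S.h m - 1)⁻¹

theorem scale_ne_zero (i : Fin n) : S.scale i ≠ 0 :=
  Finset.prod_ne_zero_iff.mpr fun m _ => inv_ne_zero (S.sub_sub_ne i m)

/-- The scalar with `xⁱ xʲ = exchange i j * xʲ xⁱ`. -/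
def exchange (i j : Fin n) : F :=
  if i < j then (S.h i - S.h j + 1) * (S.h i - S.h j)⁻¹
  else (S.h i - S.h j) * (S.h i - S.h j - 1)⁻¹

/-- For i < j the shift by j fixes `scale i`, and the shift by i changes just the factor m = i of
`scale j`. The change is the required exchange factor, which explains the choice of the product. -/
theorem scale_mul_of_lt {i j : Fin n} (hij : i < j) :
    S.scale i * S.t i (S.scale j) = S.exchange i j * (S.scale j * S.t j (S.scale i)) := by
  have h1 : S.t j (S.scale i) = S.scale i := by
    rw [scale, map_prod]
    refine Finset.prod_congr rfl fun m hm => ?_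
    have hm : m < i := Finset.mem_Iio.mp hm
    simp [S.t_h, hij.ne, (hm.trans hij).ne]
  have h2 : S.t i (S.scale j) = S.scale j * S.exchange i j := by
    have : S.exchange i j = ∏ m ∈ Finset.Iio j, if m = i then S.exchange i j else 1 := by
      simp [hij]
    rw [this, scale, ← Finset.prod_mul_distrib, map_prod]
    refine Finset.prod_congr rfl fun m _ => ?_
    split_ifs with hm
    · subst hm
      have e : S.h m - S.h j = -(S.h j - S.h m) := by ring
      have h3 := S.sub_ne hij.ne'
      have h4 := S.sub_sub_ne j m
      simp only [exchange, hij, if_true, e, map_inv₀, map_sub, S.t_h, hij.ne', if_false, map_one]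
      have h5 : S.h j - 0 - (S.h m - 1) - 1 = S.h j - S.h m := by ring
      rw [h5]
      field_simp
      ring
    · simp [S.t_h, hm, hij.ne']
  rw [h1, h2]; ring

theorem scale_mul {i j : Fin n} (hij : i ≠ j) :
    S.scale i * S.t i (S.scale j) = S.exchange i j * (S.scale j * S.t j (S.scale i)) := by
  rcases hij.lt_or_gt with h | h
  · exact S.scale_mul_of_lt h
  · rw [S.scale_mul_of_lt h, ← mul_assoc]
    have : S.exchange i j * S.exchange j i = 1 := by
      have h1 := S.sub_ne h.ne
      have h4 := S.sub_add_ne j i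
      have e : S.h i - S.h j = -(S.h j - S.h i) := by ring
      have e' : -(S.h j - S.h i) - 1 = -(S.h j - S.h i + 1) := by ring
      simp only [exchange, h, h.not_gt, if_true, if_false]
      rw [e, e']
      field_simp
    rw [this, one_mul]

/-- The action of `xⁱ`. -/
def xOp (i : Fin n) : Module.End K (MvPolynomial (Fin n) F) :=
  LinearMap.mulLeft K (C (S.scale i)) ∘ₗ (S.tau i).toLinearMap

/-- The action of `∂̄ᵢ`. -/
def dOp (i : Fin n) : Module.End K (MvPolynomial (Fin n) F) :=
  LinearMap.mulLeft K (X i) ∘ₗ (S.tau i).symm.toLinearMap ∘ₗ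
    LinearMap.mulLeft K (C (S.scale i)⁻¹)

theorem xOp_apply (i : Fin n) (v : MvPolynomial (Fin n) F) :
    S.xOp i v = C (S.scale i) * S.tau i v := rfl

theorem dOp_apply (i : Fin n) (v : MvPolynomial (Fin n) F) :
    S.dOp i v = X i * (S.tau i).symm (C (S.scale i)⁻¹ * v) := rfl

/-- Since the xⁱ are surjective, relations involving ∂̄ᵢ may be tested on vectors xⁱw, where this
formula removes ∂̄ᵢ. -/
theorem dOp_xOp (i : Fin n) (v : MvPolynomial (Fin n) F) : S.dOp i (S.xOp i v) = X i * v := by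
  rw [dOp_apply, xOp_apply, ← mul_assoc, ← C_mul, inv_mul_cancel₀ (S.scale_ne_zero i), C_1,
    one_mul, AlgEquiv.symm_apply_apply]

theorem exists_xOp_eq (i : Fin n) (v : MvPolynomial (Fin n) F) : ∃ w, S.xOp i w = v := by
  refine ⟨(S.tau i).symm (C (S.scale i)⁻¹ * v), ?_⟩
  rw [xOp_apply, AlgEquiv.apply_symm_apply, ← mul_assoc, ← C_mul,
    mul_inv_cancel₀ (S.scale_ne_zero i), C_1, one_mul]

theorem xOp_mul (i : Fin n) (p v : MvPolynomial (Fin n) F) :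
    S.xOp i (p * v) = S.tau i p * S.xOp i v := by
  rw [xOp_apply, xOp_apply, map_mul]; ring

theorem dOp_mul (i : Fin n) (p v : MvPolynomial (Fin n) F) :
    S.dOp i (p * v) = (S.tau i).symm p * S.dOp i v := by
  rw [dOp_apply, dOp_apply, mul_left_comm, map_mul]; ring

theorem xOp_xOp {i j : Fin n} (hij : i ≠ j) (v : MvPolynomial (Fin n) F) :
    S.xOp i (S.xOp j v) = C (S.exchange i j) * S.xOp j (S.xOp i v) := by
  simp only [xOp_apply, map_mul, tau_C]
  rw [← mul_assoc, ← C_mul, S.scale_mul hij, S.tau_comm i j]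
  simp only [C_mul]; ring

theorem dOp_dOp {k l : Fin n} (hkl : k ≠ l) (v : MvPolynomial (Fin n) F) :
    S.dOp k (S.dOp l v) =
      C (S.exchange k l * ((S.h k - S.h l - 1) * (S.h k - S.h l + 1)⁻¹)) *
        S.dOp l (S.dOp k v) := by
  obtain ⟨v, rfl⟩ := S.exists_xOp_eq k v
  obtain ⟨w, rfl⟩ := S.exists_xOp_eq l v
  rw [S.dOp_xOp k, dOp_mul, dOp_xOp, S.xOp_xOp hkl, dOp_mul, dOp_xOp, dOp_mul, dOp_mul, dOp_xOp,
    tau_symm_C, tau_symm_C, S.tau_symm_X_of_ne hkl, S.tau_symm_X_of_ne hkl.symm]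
  have h1 : (S.t k).symm ((S.t l).symm (S.exchange k l)) = S.exchange k l := by
    rw [exchange]
    split_ifs <;> simp [S.t_symm_h, hkl, hkl.symm]
  rw [h1]
  have h2 := S.sub_ne hkl
  have h3 := S.sub_sub_ne k l
  have h4 := S.sub_add_ne k l
  have h5 : (S.h l - S.h k) * (S.h l - S.h k - 1)⁻¹ =
      ((S.h k - S.h l - 1) * (S.h k - S.h l + 1)⁻¹) *
        ((S.h k - S.h l) * (S.h k - S.h l - 1)⁻¹) := by
    have e : S.h l - S.h k = -(S.h k - S.h l) := by ring
    have e' : -(S.h k - S.h l) - 1 = -(S.h k - S.h l + 1) := by ring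
    rw [e, e']
    field_simp
  rw [h5]
  simp only [C_mul]
  ring

/-- Here r stands for the entry R̂^{ji}_{ij}; `hr` is the one identity needed of it, common to i < j
and i > j. -/
theorem xOp_dOp_of_ne {i j : Fin n} (hij : i ≠ j) (r : F)
    (hr : r * S.exchange i j = (S.h i - S.h j + 1) * (S.h i - S.h j)⁻¹)
    (v : MvPolynomial (Fin n) F) :
    S.xOp i (S.dOp j v) = S.dOp j (C r * S.xOp i v) := by
  obtain ⟨w, rfl⟩ := S.exists_xOp_eq j v
  rw [dOp_xOp, xOp_mul, S.tau_X_of_ne hij.symm, S.xOp_xOp hij, ← mul_assoc, ← C_mul, hr, dOp_mul,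
    dOp_xOp, tau_symm_C, mul_assoc]
  congr 2
  have e : S.h j - S.h i = -(S.h i - S.h j) := by ring
  have e' : -(S.h i - S.h j) + 1 = -(S.h i - S.h j - 1) := by ring
  rw [e, e']
  simp only [map_mul, map_add, map_sub, map_inv₀, map_one, S.t_symm_h, hij, if_true, if_false]
  rw [neg_mul, inv_neg, mul_neg, neg_neg]
  congr 2 <;> ring

theorem dOp_C_mul_xOp {i k : Fin n} (r : F)
    (hr : r = if k = i then 1 else (S.h k - S.h i)⁻¹) (v : MvPolynomial (Fin n) F) :
    S.dOp k (C r * S.xOp k v) = C (S.h k - S.h i + 1)⁻¹ * X k * v := by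
  rw [dOp_mul, dOp_xOp, tau_symm_C, hr, mul_assoc]
  congr 2
  split_ifs with hk
  · subst hk; simp
  · simp only [map_sub, map_inv₀, S.t_symm_h, Ne.symm hk, if_true, if_false]
    congr 1; ring

theorem xOp_dOp_self (i : Fin n) (r : Fin n → F)
    (hr : ∀ k, r k = if k = i then 1 else (S.h k - S.h i)⁻¹) (v : MvPolynomial (Fin n) F) :
    S.xOp i (S.dOp i v) = ∑ k, S.dOp k (C (r k) * S.xOp k v) - C (S.s i) * v := by
  obtain ⟨w, rfl⟩ := S.exists_xOp_eq i v
  rw [dOp_xOp, xOp_mul, tau_X_self, sub_mul, Finset.sum_mul]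
  congr 1
  exact Finset.sum_congr rfl fun k _ => (S.dOp_C_mul_xOp (r k) (hr k) _).symm

end ShiftedField

end HDeformed
end

/-! ### Linear independence of the ordered monomials in the operators -/

noncomputable section
namespace HDeformed

namespace ShiftedField

open MvPolynomial

variable {K F : Type*} [Field K] [Field F] [Algebra K F] {n : ℕ} (S : ShiftedField K F n)

/-- Multiplication by elements of `F`. -/
def scalarOp (K F : Type*) [Field K] [Field F] [Algebra K F] (n : ℕ) :
    F →+* Module.End K (MvPolynomial (Fin n) F) :=
  (Algebra.lmul K (MvPolynomial (Fin n) F)).toRingHom.comp C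

theorem scalarOp_apply (f : F) (v : MvPolynomial (Fin n) F) : scalarOp K F n f v = C f * v := rfl

theorem smul_eq_scalarOp_mul (f : F) (φ : Module.End K (MvPolynomial (Fin n) F)) :
    f • φ = scalarOp K F n f * φ := by
  refine LinearMap.ext fun v => ?_
  rw [LinearMap.smul_apply, Module.End.mul_apply, scalarOp_apply, smul_eq_C_mul]

theorem exists_dOp_mul_orderedMonomial (a : Fin n) (l : Fin n → ℕ) :
    ∃ c, S.dOp a.rev * orderedMonomial (fun a : Fin n => S.dOp a.rev) l =
      scalarOp K F n c * orderedMonomial (fun a : Fin n => S.dOp a.rev) (l + Pi.single a 1) := by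
  refine exists_mul_orderedMonomial (scalarOp K F n) (fun a : Fin n => S.dOp a.rev)
    (fun a f => ⟨(S.t a.rev).symm f, ?_⟩) (fun a b => ?_) a l
  · refine LinearMap.ext fun v => ?_
    simp only [Module.End.mul_apply, scalarOp_apply, dOp_mul, tau_symm_C]
  · rcases eq_or_ne a b with rfl | hab
    · exact ⟨1, by simp⟩
    · refine ⟨S.exchange a.rev b.rev * ((S.h a.rev - S.h b.rev - 1) *
        (S.h a.rev - S.h b.rev + 1)⁻¹), LinearMap.ext fun v => ?_⟩
      simp only [Module.End.mul_apply, scalarOp_apply]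
      exact S.dOp_dOp (Fin.rev_injective.ne hab) v

/-- The ordered monomials in the `∂̄ᵢ`, applied to `1`. -/
def lowering (l : Fin n → ℕ) : MvPolynomial (Fin n) F :=
  orderedMonomial (fun a : Fin n => S.dOp a.rev) l 1

/-- Induction on the degree: Γₖw = ∂̄ₖ(xᵏw), and xᵏ does not raise the degree of w. -/
theorem mem_span_lowering (d : ℕ) (v : MvPolynomial (Fin n) F) (hv : v.totalDegree ≤ d) :
    v ∈ Submodule.span F (S.lowering '' {l | ∑ i, l i ≤ d}) := by
  have hconst : ∀ d (c : F), (C c : MvPolynomial (Fin n) F) ∈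
      Submodule.span F (S.lowering '' {l | ∑ i, l i ≤ d}) := by
    intro d c
    have h1 : S.lowering 0 ∈ Submodule.span F (S.lowering '' {l | ∑ i, l i ≤ d}) :=
      Submodule.subset_span ⟨0, by simp, rfl⟩
    have h2 := Submodule.smul_mem _ c h1
    rwa [lowering, orderedMonomial_zero, Module.End.one_apply, smul_eq_C_mul, mul_one] at h2
  induction d generalizing v with
  | zero =>
    rw [Nat.le_zero, totalDegree_eq_zero_iff_eq_C] at hv
    rw [hv]
    exact hconst 0 _
  | succ d ih =>
    have hd : ∀ k, ∀ w ∈ Submodule.span F (S.lowering '' {l | ∑ i, l i ≤ d}),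
        S.dOp k w ∈ Submodule.span F (S.lowering '' {l | ∑ i, l i ≤ d + 1}) := by
      intro k w hw
      induction hw using Submodule.span_induction with
      | mem w hw =>
        obtain ⟨l, hl, rfl⟩ := hw
        obtain ⟨c, hc⟩ := S.exists_dOp_mul_orderedMonomial k.rev l
        have h2 := DFunLike.congr_fun hc 1
        rw [Fin.rev_rev, Module.End.mul_apply, Module.End.mul_apply, scalarOp_apply,
          ← smul_eq_C_mul] at h2
        rw [lowering, h2]
        refine Submodule.smul_mem _ _ (Submodule.subset_span ⟨_, ?_, rfl⟩)
        have : ∑ i, l i ≤ d := hl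
        simpa [Finset.sum_add_distrib] using this
      | zero => simp
      | add u v _ _ hu hv => rw [map_add]; exact Submodule.add_mem _ hu hv
      | smul f v _ hv =>
        rw [smul_eq_C_mul, dOp_mul, tau_symm_C, ← smul_eq_C_mul]
        exact Submodule.smul_mem _ _ hv
    rw [v.as_sum]
    refine Submodule.sum_mem _ fun e he => ?_
    have hed : (e.sum fun _ k => k) ≤ d + 1 := (le_totalDegree he).trans hv
    by_cases he0 : e = 0
    · rw [he0]; exact hconst _ _
    · obtain ⟨k, hk⟩ := Finsupp.ne_iff.mp he0
      have hk1 : Finsupp.single k 1 ≤ e := by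
        rw [Finsupp.single_le_iff]; exact Nat.one_le_iff_ne_zero.mpr hk
      obtain ⟨e', rfl⟩ := exists_add_of_le hk1
      have hX : monomial (Finsupp.single k 1 + e') (coeff (Finsupp.single k 1 + e') v) =
          X k * monomial e' (coeff (Finsupp.single k 1 + e') v) := by
        rw [X, monomial_mul, one_mul]
      rw [hX, ← S.dOp_xOp]
      refine hd k _ (ih _ ?_)
      rw [xOp_apply]
      refine (totalDegree_mul _ _).trans ?_
      rw [totalDegree_C, zero_add, tau_apply]
      refine (totalDegree_shiftHom_le _).trans ((totalDegree_monomial_le _ _).trans ?_)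
      rw [Finsupp.sum_add_index' (by simp) (by simp), Finsupp.sum_single_index rfl] at hed
      exact Nat.le_of_add_le_add_left (by rwa [add_comm 1 d])

/-- In degree at most d these vectors span a space containing all monomials of degree at most d,
which are independent and equally numerous. -/
theorem linearIndependent_lowering : LinearIndependent F S.lowering := by
  have key : ∀ d : ℕ, LinearIndependent F
      fun l : {l : Fin n → ℕ | ∑ i, l i ≤ d} => S.lowering l := by
    intro d
    have hfin : {l : Fin n → ℕ | ∑ i, l i ≤ d}.Finite :=
      (Set.finite_Iic fun _ => d).subset fun l hl i =>
        (Finset.single_le_sum (fun j _ => Nat.zero_le (l j)) (Finset.mem_univ i)).trans hl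
    have := hfin.fintype
    rw [linearIndependent_iff_card_le_finrank_span]
    let b : {l : Fin n → ℕ | ∑ i, l i ≤ d} → Submodule.span F
        (Set.range fun l : {l : Fin n → ℕ | ∑ i, l i ≤ d} => S.lowering l) := fun l =>
      ⟨monomial (Finsupp.equivFunOnFinite.symm l.1) 1, by
        have := S.mem_span_lowering d (monomial (Finsupp.equivFunOnFinite.symm l.1) 1) (by
          refine (totalDegree_monomial_le _ _).trans ?_
          rw [Finsupp.sum_fintype _ _ (by simp)]
          exact l.2)
        rwa [Set.image_eq_range] at this⟩
    have hb : LinearIndependent F b := by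
      refine LinearIndependent.of_comp (Submodule.subtype _) ?_
      exact (basisMonomials (Fin n) F).linearIndependent.comp
        (fun l : {l : Fin n → ℕ | ∑ i, l i ≤ d} => Finsupp.equivFunOnFinite.symm l.1)
        (Finsupp.equivFunOnFinite.symm.injective.comp Subtype.val_injective)
    have : Module.Finite F (Submodule.span F
        (Set.range fun l : {l : Fin n → ℕ | ∑ i, l i ≤ d} => S.lowering l)) :=
      FiniteDimensional.span_of_finite F (Set.finite_range _)
    exact hb.fintype_card_le_finrank
  rw [linearIndependent_iff_finset_linearIndependent]
  intro s
  exact (key (s.sup fun l => ∑ i, l i)).comp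
    (fun l : s => ⟨l.1, Finset.le_sup (f := fun l : Fin n → ℕ => ∑ i, l i) l.2⟩)
    fun a b h => Subtype.ext (congrArg (fun l => l.1) h)

/-- An operator on `F[Γ₁, …, Γₙ]` that shifts the `hᵢ` by `w`. -/
def HasWeight (w : Fin n → ℤ) (φ : Module.End K (MvPolynomial (Fin n) F)) : Prop :=
  ∀ i v, φ (C (S.h i) * v) = C (S.h i - w i) * φ v

variable {S}

theorem HasWeight.one : S.HasWeight 0 1 := fun i v => by simp

theorem HasWeight.mul {w w' : Fin n → ℤ} {φ ψ : Module.End K (MvPolynomial (Fin n) F)}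
    (hφ : S.HasWeight w φ) (hψ : S.HasWeight w' ψ) : S.HasWeight (w + w') (φ * ψ) := by
  intro i v
  have h1 : C (S.h i - w' i) * ψ v = C (S.h i) * ψ v - (w' i : ℤ) • ψ v := by
    rw [C_sub, sub_mul, zsmul_eq_mul, map_intCast]
  rw [Module.End.mul_apply, hψ, h1, map_sub, hφ, map_zsmul, Module.End.mul_apply, zsmul_eq_mul]
  simp only [Pi.add_apply, Int.cast_add, C_sub, C_add, map_intCast]
  ring

theorem HasWeight.pow {w : Fin n → ℤ} {φ : Module.End K (MvPolynomial (Fin n) F)}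
    (hφ : S.HasWeight w φ) (k : ℕ) : S.HasWeight (k • w) (φ ^ k) := by
  induction k with
  | zero => simpa using HasWeight.one
  | succ k ih => rw [pow_succ, succ_nsmul]; exact ih.mul hφ

theorem HasWeight.orderedMonomial {m : ℕ} {r : Fin m → Module.End K (MvPolynomial (Fin n) F)}
    {w : Fin m → Fin n → ℤ} (hr : ∀ a, S.HasWeight (w a) (r a)) (k : Fin m → ℕ) :
    S.HasWeight (∑ a, k a • w a) (HDeformed.orderedMonomial r k) := by
  induction m with
  | zero => simpa [HDeformed.orderedMonomial] using HasWeight.one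
  | succ m ih =>
    rw [orderedMonomial_succ, Fin.sum_univ_succ]
    exact ((hr 0).pow _).mul (ih (fun a => hr _) _)

/-- Polynomials in the hᵢ over K are enough test scalars to tell weights apart, and K-linearity of φ
handles their coefficients. -/
theorem HasWeight.apply_aeval {w : Fin n → ℤ} {φ : Module.End K (MvPolynomial (Fin n) F)}
    (hφ : S.HasWeight w φ) (p : MvPolynomial (Fin n) K) (v : MvPolynomial (Fin n) F) :
    φ (C (aeval S.h p) * v) = C (aeval (fun i => S.h i - w i) p) * φ v := by
  induction p using MvPolynomial.induction_on generalizing v with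
  | C a =>
    have : ∀ u : MvPolynomial (Fin n) F, C (algebraMap K F a) * u = a • u := by
      intro u
      rw [← smul_eq_C_mul, algebraMap_smul]
    rw [aeval_C, aeval_C, this, this, map_smul]
  | add p q hp hq => simp only [map_add, add_mul, hp, hq]
  | mul_X p i hp =>
    rw [map_mul (aeval _), map_mul (aeval _), aeval_X, aeval_X, C_mul, mul_assoc, hp, hφ,
      C_mul, mul_assoc]

variable (S)

theorem hasWeight_xOp (i : Fin n) : S.HasWeight (Pi.single i 1) (S.xOp i) := by
  intro j v
  rw [xOp_mul, tau_C, t_h]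
  congr 3
  simp [Pi.single_apply]

theorem hasWeight_dOp (i : Fin n) : S.HasWeight (-Pi.single i 1) (S.dOp i) := by
  intro j v
  rw [dOp_mul, tau_symm_C, t_symm_h]
  congr 2
  simp [Pi.single_apply]

/-- The operators `∂̄ₙ, …, ∂̄₁, x¹, …, xⁿ`. -/
def generatorOps : Fin (n + n) → Module.End K (MvPolynomial (Fin n) F) :=
  Fin.append (fun a => S.dOp a.rev) S.xOp

/-- The weight of an ordered monomial. -/
def weight (m : Fin (n + n) → ℕ) : Fin n → ℤ :=
  -- The ∂̄ᵢ are listed in decreasing order, hence `rev`.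
  fun i => m (Fin.natAdd n i) - m (Fin.castAdd n i.rev)

theorem hasWeight_orderedMonomial (m : Fin (n + n) → ℕ) :
    S.HasWeight (weight m) (orderedMonomial S.generatorOps m) := by
  have h := HasWeight.orderedMonomial (S := S) (r := S.generatorOps)
    (w := Fin.append (fun a : Fin n => -Pi.single a.rev 1) fun a => Pi.single a 1)
    (fun a => by
      refine Fin.addCases (fun b => ?_) (fun b => ?_) a
      · rw [generatorOps, Fin.append_left, Fin.append_left]; exact S.hasWeight_dOp _
      · rw [generatorOps, Fin.append_right, Fin.append_right]; exact S.hasWeight_xOp _) m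
  convert h using 1
  ext i
  have : ∀ a : Fin n, i = a.rev ↔ i.rev = a := fun a => by rw [← Fin.rev_inj, Fin.rev_rev]
  rw [Fin.sum_univ_add]
  simp only [Fin.append_left, Fin.append_right, weight, Pi.add_apply, Finset.sum_apply,
    Pi.smul_apply, Pi.neg_apply, Pi.single_apply, this]
  simp
  ring

theorem exists_orderedMonomial_apply_one (m : Fin (n + n) → ℕ) : ∃ c : F, c ≠ 0 ∧
    orderedMonomial S.generatorOps m 1 = C c * S.lowering fun a => m (Fin.castAdd n a) := by
  have hx : ∃ c : F, c ≠ 0 ∧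
      (orderedMonomial S.xOp (fun a => m (Fin.natAdd n a)) * 1) 1 = C c := by
    refine orderedMonomial_mul_induction S.xOp (fun φ => ∃ c : F, c ≠ 0 ∧ φ 1 = C c) ?_ _ _
      ⟨1, one_ne_zero, by simp⟩
    rintro a φ ⟨c, hc, h⟩
    refine ⟨S.scale a * S.t a c, mul_ne_zero (S.scale_ne_zero a) (by simpa using hc), ?_⟩
    rw [Module.End.mul_apply, h, xOp_apply, tau_C, C_mul]
  have hd : ∀ c : F, c ≠ 0 → ∃ c' : F, c' ≠ 0 ∧ ∀ v,
      (orderedMonomial (fun a : Fin n => S.dOp a.rev) (fun a => m (Fin.castAdd n a)) * 1)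
        (C c * v) = C c' *
      (orderedMonomial (fun a : Fin n => S.dOp a.rev) (fun a => m (Fin.castAdd n a)) * 1) v := by
    intro c hc
    refine orderedMonomial_mul_induction (fun a : Fin n => S.dOp a.rev)
      (fun φ => ∃ c' : F, c' ≠ 0 ∧ ∀ v, φ (C c * v) = C c' * φ v) ?_ _ _ ⟨c, hc, by simp⟩
    rintro a φ ⟨c', hc', h⟩
    refine ⟨(S.t a.rev).symm c', by simpa using hc', fun v => ?_⟩
    rw [Module.End.mul_apply, h, dOp_mul, tau_symm_C, Module.End.mul_apply]
  obtain ⟨c, hc, h⟩ := hx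
  obtain ⟨c', hc', h'⟩ := hd c hc
  refine ⟨c', hc', ?_⟩
  rw [mul_one] at h
  have h2 := h' 1
  rw [mul_one, mul_one] at h2
  rw [generatorOps, orderedMonomial_append, Module.End.mul_apply, h, h2, lowering]

theorem linearIndependent_orderedMonomial [CharZero K] :
    LinearIndependent F (orderedMonomial S.generatorOps) := by
  have : CharZero F := charZero_of_injective_algebraMap (algebraMap K F).injective
  rw [linearIndependent_iff']
  intro s g hg m hm
  let χ : (Fin n → ℤ) → MvPolynomial (Fin n) K →* MvPolynomial (Fin n) F := fun w =>
    ((C : F →+* MvPolynomial (Fin n) F).comp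
      (aeval (R := K) fun i => S.h i - (w i : F) : MvPolynomial (Fin n) K →+* F) :
        MvPolynomial (Fin n) K →+* MvPolynomial (Fin n) F)
  have hχ : ∀ w p, χ w p = C (aeval (fun i => S.h i - (w i : F)) p) := fun w p => rfl
  have hχi : Function.Injective χ := by
    intro w w' h
    ext i
    have h1 := DFunLike.congr_fun h (X i)
    rw [hχ, hχ, aeval_X, aeval_X] at h1
    have h2 := C_injective _ _ h1
    exact_mod_cast sub_right_injective h2
  -- Dedekind's theorem for the characters p ↦ p(h - w), distinct for distinct w in characteristic
  -- zero. The relation evaluated at p(h) is a combination of them, so its part of each weight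
  -- vanishes at 1.
  have hded := (linearIndependent_monoidHom (MvPolynomial (Fin n) K)
    (MvPolynomial (Fin n) F)).comp χ hχi
  rw [linearIndependent_iff'] at hded
  have hw := hded (s.image weight)
    (fun w => ∑ m ∈ s with weight m = w, C (g m) * orderedMonomial S.generatorOps m 1) (by
      ext1 p
      have h1 := DFunLike.congr_fun hg (C (aeval S.h p) * 1)
      rw [LinearMap.sum_apply, LinearMap.zero_apply] at h1
      rw [Finset.sum_apply, Pi.zero_apply, ← h1,
        ← Finset.sum_fiberwise_of_maps_to (fun m hm => Finset.mem_image_of_mem weight hm)]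
      refine Finset.sum_congr rfl fun w _ => ?_
      rw [Pi.smul_apply, smul_eq_mul, Finset.sum_mul]
      refine Finset.sum_congr rfl fun m hm => ?_
      rw [LinearMap.smul_apply, (S.hasWeight_orderedMonomial m).apply_aeval, smul_eq_C_mul,
        (Finset.mem_filter.mp hm).2, Function.comp_apply, hχ]
      ring) (weight m) (Finset.mem_image_of_mem _ hm)
  choose c hc0 hc using S.exists_orderedMonomial_apply_one
  -- For a fixed weight the ∂̄-exponents determine the x-exponents.
  have hli := S.linearIndependent_lowering.comp
    (fun m' : {m' : Fin (n + n) → ℕ // weight m' = weight m} =>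
      fun a => m'.1 (Fin.castAdd n a)) (by
      rintro ⟨m₁, h₁⟩ ⟨m₂, h₂⟩ h
      refine Subtype.ext (funext fun a => ?_)
      refine Fin.addCases (fun b => congrFun h b) (fun b => ?_) a
      have h3 := congrFun (h₁.trans h₂.symm) b
      have h4 : m₁ (Fin.castAdd n b.rev) = m₂ (Fin.castAdd n b.rev) := congrFun h b.rev
      simp only [weight, h4, sub_left_inj, Nat.cast_inj] at h3
      exact h3)
  rw [linearIndependent_iff'] at hli
  have h0 := hli (s.subtype fun m' => weight m' = weight m) (fun m' => g m'.1 * c m'.1) (by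
    rw [← hw, ← Finset.sum_subtype_eq_sum_filter]
    refine Finset.sum_congr rfl fun m' _ => ?_
    rw [hc, Function.comp_apply, smul_eq_C_mul, C_mul, mul_assoc]) ⟨m, rfl⟩ (by simpa using hm)
  exact (mul_eq_zero.mp h0).resolve_right (hc0 m)

end ShiftedField

end HDeformed
end

/-! ### The fraction field of Ū(n) -/

noncomputable section
namespace HDeformed

variable {K : Type*} [Field K] {n : ℕ}

theorem denominators_le_nonZeroDivisors [CharZero K] :
    denominators K n ≤ nonZeroDivisors (MvPolynomial (Fin n) K) := by
  rw [denominators, Submonoid.closure_le]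
  rintro p ⟨i, j, k, hij, rfl⟩
  refine mem_nonZeroDivisors_of_ne_zero fun h => ?_
  -- At this point the denominator takes the value (1 - k) - 0 + k = 1.
  have h1 := congrArg (MvPolynomial.eval fun m => if m = i then (1 - k : K) else 0) h
  simp [hij.symm] at h1

instance [CharZero K] : IsDomain (UBar K n) :=
  IsLocalization.isDomain_localization denominators_le_nonZeroDivisors

theorem translate_comm (i j : Fin n) (c d : ℤ) (f : UBar K n) :
    translate i c (translate j d f) = translate j d (translate i c f) := by
  have h : (translate i c).comp (translate j d) =
      (translate j d).comp (translate i c : UBar K n →+* UBar K n) := by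
    refine IsLocalization.ringHom_ext (denominators K n) (MvPolynomial.ringHom_ext ?_ ?_)
    · intro a
      simp only [RingHom.comp_apply, translate_algebraMap, ← MvPolynomial.algebraMap_eq,
        AlgHom.commutes]
    · intro m
      have hm : ∀ (j : Fin n) (c : ℤ), translate j c (algebraMap _ (UBar K n) (MvPolynomial.X m)) =
          algebraMap _ _ (MvPolynomial.X m) + ((if m = j then c else 0 : ℤ) : UBar K n) :=
        fun j c => translate_hTilde m j c
      simp only [RingHom.comp_apply, hm, map_add, map_intCast]
      exact add_right_comm _ _ _
  exact DFunLike.congr_fun h f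

/-- The automorphism `f ↦ f[-εⱼ]` of `Ū(n)`. -/
def shiftEquiv (j : Fin n) : UBar K n ≃ₐ[K] UBar K n :=
  { translate j (-1) with
    invFun := translate j 1
    left_inv := translate_translate j 1 (-1) (by simp)
    right_inv := translate_translate j (-1) 1 (by simp)
    commutes' := translate_algebraMap_base j (-1) }

variable (K n) in
/-- The field of fractions of `Ū(n)`. -/
abbrev UField : Type _ := FractionRing (UBar K n)

/-- The automorphism `f ↦ f[-εⱼ]` of the field of fractions. -/
def fieldShift (j : Fin n) : UField K n ≃ₐ[K] UField K n :=
  IsFractionRing.algEquivOfAlgEquiv (shiftEquiv j)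

theorem fieldShift_algebraMap (j : Fin n) (f : UBar K n) :
    fieldShift j (algebraMap _ (UField K n) f) = algebraMap _ _ (translate j (-1) f) :=
  IsFractionRing.algEquivOfAlgEquiv_algebraMap _ _

/-- A solution of the difference equations over `Ū(n)` gives one over its field of fractions. -/
def shiftedField [CharZero K] (σ : Fin n → UBar K n)
    (hσ : ∀ i j, (hTilde i - hTilde j) * delta j (σ i) = σ i - σ j) :
    ShiftedField K (UField K n) n where
  h i := algebraMap _ _ (hTilde i)
  t := fieldShift
  s i := algebraMap _ _ (σ i)
  t_h i j := by
    rw [fieldShift_algebraMap, translate_hTilde]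
    split_ifs <;> simp [sub_eq_add_neg]
  h_ne i j hij c := by
    have h := ((isUnit_hTilde_sub_add (K := K) hij c).map (algebraMap _ (UField K n))).ne_zero
    simpa using h
  t_comm i j f := by
    obtain ⟨a, b, rfl⟩ := IsLocalization.exists_mk'_eq (nonZeroDivisors (UBar K n)) f
    rw [IsFractionRing.mk'_eq_div]
    simp only [map_div₀, fieldShift_algebraMap, translate_comm i j]
  t_s i j := by
    rw [fieldShift_algebraMap, ← map_sub, ← map_sub, ← map_mul, ← map_sub, ← delta, hσ]

/-! ### The representation and sufficiency -/

section Representation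

open ShiftedField MvPolynomial

variable {F : Type*} [Field F] [Algebra K F] (S : ShiftedField K F n) (ι : UBar K n →ₐ[K] F)

/-- The operator on `F[Γ₁, …, Γₙ]` by which a letter acts. -/
def letterOp : Letter K n → Module.End K (MvPolynomial (Fin n) F)
  | .scalar f => scalarOp K F n (ι f)
  | .x i => S.xOp i
  | .d i => S.dOp i

theorem lift_wS (f : UBar K n) :
    FreeAlgebra.lift K (letterOp S ι) (wS f) = scalarOp K F n (ι f) :=
  FreeAlgebra.lift_ι_apply _ _

theorem lift_wX (i : Fin n) : FreeAlgebra.lift K (letterOp S ι) (wX K i) = S.xOp i :=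
  FreeAlgebra.lift_ι_apply _ _

theorem lift_wD (i : Fin n) : FreeAlgebra.lift K (letterOp S ι) (wD K i) = S.dOp i :=
  FreeAlgebra.lift_ι_apply _ _

theorem scalarOp_zero : scalarOp K F n 0 = 0 := RingHom.map_zero _

theorem scalarOp_one : scalarOp K F n 1 = 1 := RingHom.map_one _

variable {ι} (hι : ∀ i, ι (hTilde i) = S.h i)

include hι

theorem map_invH {i j : Fin n} (hij : i ≠ j) : ι (invH K i j hij) = (S.h i - S.h j)⁻¹ := by
  refine eq_inv_of_mul_eq_one_right ?_
  rw [← hι, ← hι, ← map_sub, ← map_mul, sub_mul_invH, map_one]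

theorem map_rHat_anti_of_lt {i j : Fin n} (hij : i < j) :
    ι (rHat K i j j i) = ((S.h i - S.h j) ^ 2 - 1) * (S.h i - S.h j)⁻¹ ^ 2 := by
  rw [rHat_anti_of_lt hij, map_mul, map_sub, map_pow, map_pow, map_sub, map_one,
    map_invH S hι, hι, hι]

theorem xOp_mul_xOp (i j : Fin n) : S.xOp i * S.xOp j =
    ∑ k, ∑ l, scalarOp K F n (ι (rHat K i j k l)) * S.xOp k * S.xOp l := by
  have hF0 : ∀ k l, scalarOp K F n (ι 0) * S.xOp k * S.xOp l = 0 := fun k l => by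
    rw [map_zero, scalarOp_zero, zero_mul, zero_mul]
  rcases eq_or_ne i j with rfl | hij
  · rw [sum_rHat_lower_self (fun f k l => scalarOp K F n (ι f) * S.xOp k * S.xOp l) hF0,
      map_one, scalarOp_one, one_mul]
  rw [sum_rHat_lower (fun f k l => scalarOp K F n (ι f) * S.xOp k * S.xOp l) hF0 hij]
  refine LinearMap.ext fun v => ?_
  simp only [Module.End.mul_apply, LinearMap.add_apply, scalarOp_apply]
  rw [S.xOp_xOp hij, ← mul_assoc, ← C_mul, ← add_mul, ← C_add, map_invH S hι]
  congr 2
  have h0 := S.sub_ne hij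
  rcases hij.lt_or_gt with h | h
  · rw [map_rHat_anti_of_lt S hι h]
    simp only [exchange, h, if_true]
    field_simp
    ring
  · rw [rHat_anti_of_le h.le, map_one]
    simp only [exchange, h.not_gt, if_false]
    have h1 := S.sub_sub_ne i j
    field_simp
    ring

theorem dOp_mul_dOp (k l : Fin n) : S.dOp l * S.dOp k =
    ∑ i, ∑ j, S.dOp j * S.dOp i * scalarOp K F n (ι (rHat K i j k l)) := by
  have hF0 : ∀ i j, S.dOp j * S.dOp i * scalarOp K F n (ι 0) = 0 := fun i j => by
    rw [map_zero, scalarOp_zero, mul_zero]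
  rcases eq_or_ne k l with rfl | hkl
  · rw [sum_rHat_upper_self (fun f i j => S.dOp j * S.dOp i * scalarOp K F n (ι f)) hF0,
      map_one, scalarOp_one, mul_one]
  rw [sum_rHat_upper (fun f i j => S.dOp j * S.dOp i * scalarOp K F n (ι f)) hF0 hkl]
  refine LinearMap.ext fun v => ?_
  simp only [Module.End.mul_apply, LinearMap.add_apply, scalarOp_apply, dOp_mul, tau_symm_C]
  rw [S.dOp_dOp hkl, ← mul_assoc, ← C_mul, ← add_mul, ← C_add, map_invH S hι]
  have h0 := S.sub_ne hkl
  have h1 : (S.t l).symm ((S.t k).symm (S.h k - S.h l)⁻¹) = (S.h k - S.h l)⁻¹ := by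
    simp [S.t_symm_h, hkl, hkl.symm]
  have h2 : (S.t k).symm ((S.t l).symm (ι (rHat K l k k l))) = ι (rHat K l k k l) := by
    rcases hkl.lt_or_gt with h | h
    · rw [rHat_anti_of_le h.le]; simp
    · rw [map_rHat_anti_of_lt S hι h]; simp [S.t_symm_h, hkl, hkl.symm]
  rw [h1, h2]
  have h3 : (S.h k - S.h l)⁻¹ + ι (rHat K l k k l) *
      (S.exchange k l * ((S.h k - S.h l - 1) * (S.h k - S.h l + 1)⁻¹)) = 1 := by
    have h4 := S.sub_add_ne k l
    have h5 := S.sub_sub_ne k l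
    rcases hkl.lt_or_gt with h | h
    · rw [rHat_anti_of_le h.le, map_one]
      simp only [exchange, h, if_true]
      field_simp
      ring
    · rw [map_rHat_anti_of_lt S hι h]
      simp only [exchange, h.not_gt, if_false]
      have e : S.h l - S.h k = -(S.h k - S.h l) := by ring
      rw [e]
      field_simp
      ring
  rw [h3, C_1, one_mul]

theorem xOp_mul_dOp (i j : Fin n) : S.xOp i * S.dOp j =
    (∑ k, ∑ l, S.dOp k * scalarOp K F n (ι (rHat K k i l j)) * S.xOp l) -
      if i = j then scalarOp K F n (S.s i) else 0 := by
  have hF0 : ∀ k l, S.dOp k * scalarOp K F n (ι 0) * S.xOp l = 0 := fun k l => by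
    rw [map_zero, scalarOp_zero, mul_zero, zero_mul]
  rcases eq_or_ne i j with rfl | hij
  · rw [sum_rHat_mixed_self (fun f k l => S.dOp k * scalarOp K F n (ι f) * S.xOp l) hF0,
      if_pos rfl]
    refine LinearMap.ext fun v => ?_
    simp only [Module.End.mul_apply, LinearMap.sub_apply, LinearMap.sum_apply, scalarOp_apply]
    refine S.xOp_dOp_self i (fun k => ι (rHat K k i k i)) (fun k => ?_) v
    split_ifs with hk
    · rw [hk, rHat_anti_of_le le_rfl, map_one]
    · rw [rHat_diag hk, map_invH S hι]
  · rw [sum_rHat_mixed (fun f k l => S.dOp k * scalarOp K F n (ι f) * S.xOp l) hF0 hij,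
      if_neg hij, sub_zero]
    refine LinearMap.ext fun v => ?_
    simp only [Module.End.mul_apply, scalarOp_apply]
    refine S.xOp_dOp_of_ne hij _ ?_ v
    have h0 := S.sub_ne hij
    rcases hij.lt_or_gt with h | h
    · rw [rHat_anti_of_le h.le, map_one]
      simp [exchange, h]
    · have h5 := S.sub_sub_ne i j
      have e : S.h j - S.h i = -(S.h i - S.h j) := by ring
      rw [map_rHat_anti_of_lt S hι h]
      simp only [exchange, h.not_gt, if_false]
      rw [e]
      field_simp
      ring

variable {σ : Fin n → UBar K n} (hσ : ∀ i, ι (σ i) = S.s i)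

include hσ

theorem lift_rel {a b : Words K n} (h : Rel σ a b) :
    FreeAlgebra.lift K (letterOp S ι) a = FreeAlgebra.lift K (letterOp S ι) b := by
  have hone : ∀ i j : Fin n, FreeAlgebra.lift K (letterOp S ι) (if i = j then 1 else 0) =
      scalarOp K F n (if i = j then 1 else 0) := by
    intro i j
    split_ifs
    · rw [map_one, scalarOp_one]
    · rw [map_zero, scalarOp_zero]
  cases h with
  | scalar_algebraMap c =>
    rw [lift_wS, AlgHom.commutes, AlgHom.commutes]
    refine LinearMap.ext fun v => ?_
    rw [scalarOp_apply, Module.algebraMap_end_apply, ← smul_eq_C_mul, algebraMap_smul]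
  | scalar_add f g => rw [map_add, lift_wS, lift_wS, lift_wS, map_add ι, RingHom.map_add]
  | scalar_mul f g => rw [map_mul, lift_wS, lift_wS, lift_wS, map_mul ι, RingHom.map_mul]
  | weight_x i j =>
    rw [map_mul, map_mul, map_add, lift_wS, lift_wX, hone, ← RingHom.map_add, hι]
    refine LinearMap.ext fun v => ?_
    rw [Module.End.mul_apply, Module.End.mul_apply, scalarOp_apply, scalarOp_apply, xOp_mul,
      tau_C, map_add, t_h]
    split_ifs <;> simp
  | weight_d i j =>
    rw [map_mul, map_mul, map_sub, lift_wS, lift_wD, hone, ← RingHom.map_sub, hι]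
    refine LinearMap.ext fun v => ?_
    rw [Module.End.mul_apply, Module.End.mul_apply, scalarOp_apply, scalarOp_apply, dOp_mul,
      tau_symm_C, map_sub, t_symm_h]
    split_ifs <;> simp
  | x_x i j =>
    simp only [map_mul, map_sum, lift_wS, lift_wX]
    exact xOp_mul_xOp S hι i j
  | d_d k l =>
    simp only [map_mul, map_sum, lift_wS, lift_wD]
    exact dOp_mul_dOp S hι k l
  | x_d i j =>
    simp only [map_mul, map_sum, map_sub, lift_wS, lift_wD, lift_wX]
    rw [xOp_mul_dOp S hι i j]
    split_ifs
    · rw [lift_wS, hσ]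
    · rw [map_zero]

/-- The representation of `Diff_h(σ₁, …, σₙ)` on `F[Γ₁, …, Γₙ]`. -/
def representation : Diff σ →ₐ[K] Module.End K (MvPolynomial (Fin n) F) :=
  RingQuot.liftAlgHom K ⟨FreeAlgebra.lift K (letterOp S ι), fun _ _ h => lift_rel S hι hσ h⟩

theorem representation_quot (p : Words K n) :
    representation S hι hσ (quot σ p) = FreeAlgebra.lift K (letterOp S ι) p :=
  RingQuot.liftAlgHom_mkAlgHom_apply _ _ _ _

theorem representation_smul (f : UBar K n) (v : Diff σ) :
    representation S hι hσ (f • v) = ι f • representation S hι hσ v := by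
  rw [smul_eq, map_mul, smul_eq_scalarOp_mul]
  congr 1
  exact (representation_quot S hι hσ _).trans (lift_wS S ι f)

theorem representation_generators (a : Fin (n + n)) :
    representation S hι hσ (generators σ a) = S.generatorOps a := by
  refine Fin.addCases (fun b => ?_) (fun b => ?_) a
  · rw [generators, generatorOps, Fin.append_left, Fin.append_left]
    exact (representation_quot S hι hσ _).trans (lift_wD S ι _)
  · rw [generators, generatorOps, Fin.append_right, Fin.append_right]
    exact (representation_quot S hι hσ _).trans (lift_wX S ι _)

/-- The representation is semilinear along ι and carries ordered monomials to ordered monomials, so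
a relation over Ū(n) becomes one over F. -/
theorem linearIndependent_of_shiftedField [CharZero K] (hinj : Function.Injective ι) :
    LinearIndependent (UBar K n) (orderedMonomial (generators σ)) := by
  have h := S.linearIndependent_orderedMonomial
  rw [linearIndependent_iff'] at h ⊢
  intro s g hg m hm
  have h1 := congrArg (representation S hι hσ) hg
  rw [map_sum, map_zero] at h1
  refine hinj ?_
  rw [map_zero]
  refine h s (fun m => ι (g m)) ?_ m hm
  rw [← h1]
  refine Finset.sum_congr rfl fun m _ => ?_
  rw [representation_smul, map_orderedMonomial]
  simp only [representation_generators]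

end Representation

theorem linearIndependent_orderedMonomial_generators [CharZero K] (σ : Fin n → UBar K n)
    (hσ : ∀ i j, (hTilde i - hTilde j) * delta j (σ i) = σ i - σ j) :
    LinearIndependent (UBar K n) (orderedMonomial (generators σ)) :=
  linearIndependent_of_shiftedField (shiftedField σ hσ)
    (ι := IsScalarTower.toAlgHom K (UBar K n) (UField K n)) (fun _ => rfl) (fun _ => rfl)
    (IsFractionRing.injective (UBar K n) (UField K n))

end HDeformed
end

theorem mainTheorem2 {K : Type*} [Field K] [CharZero K] (n : ℕ)
    (σ : Fin n → HDeformed.UBar K n) :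
    HDeformed.HasPBW (HDeformed.UBar K n) (HDeformed.generators σ) ↔
      ∀ i j : Fin n,
        (HDeformed.hTilde i - HDeformed.hTilde j) * HDeformed.delta j (σ i) = σ i - σ j := by
  refine ⟨HDeformed.delta_eq_of_hasPBW, fun hσ => ?_⟩
  refine ⟨Module.Basis.mk (HDeformed.linearIndependent_orderedMonomial_generators σ hσ)
    (HDeformed.span_orderedMonomial_generators σ).ge, fun k => ?_⟩
  rw [Module.Basis.mk_apply, HDeformed.orderedMonomial]
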